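/- **Theorem 3.1.** Let $(\alpha_n)_{n\ge 0}$ be complex numbers with $|\alpha_n|<1$ and $\alpha_{n+p}=\alpha_n$ for all $n$, where $p\ge 2$ is even. Let $\Phi_n$ be the monic polynomials given by $\Phi_0=1$, $\Phi_{n+1}(z)=z\Phi_n(z)-\bar\alpha_n\Phi_n^*(z)$, where $\Phi_n^*(z)=z^n\,\overline{\Phi_n(1/\bar z)}$. Put $\rho_n=(1-|\alpha_n|^2)^{1/2}$, $$A_n(z)=\frac1{\rho_n}\begin{pmatrix} z&-\bar\alpha_n\\-z\alpha_n&1\end{pmatrix},\qquad T_n=A_{n-1}\cdots A_0,\qquad \Delta(z)=z^{-p/2}\,\mathrm{Tr}\,T_p(z).$$ Let $B=\{z:|z|=1,\ \Delta(z)\in[-2,2]\}$. There are real numbers $$x_1<y_1\le x_2<y_2\le\cdots\le x_p<y_p\le x_{p+1}=x_1+2\pi,\qquad 0\le x_1<2\pi,$$ such that $B$ is the union of the $p$ bands $B_j=\{e^{i\theta}: x_j\le\theta\le y_j\}$, $\Delta(e^{ix_j})$ and $\Delta(e^{iy_j})$ are each $2$ or $-2$, and $\Delta(e^{i\theta})\ne\pm2$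 for $x_j<\theta<y_j$. The $j$-th gap is $\{e^{i\theta}: y_j<\theta<x_{j+1}\}$ ($1\le j\le p$); it is empty (closed) if $y_j=x_{j+1}$. There is a unique equilibrium measure $\kappa$ of $B$, that is, a probability measure on $B$ whose logarithmic energy $\iint\log\frac1{|z-w|}\,d\kappa(z)\,d\kappa(w)$ is finite and minimal among all probability measures on $B$. For any such choice of $x_j,y_j$ write $$k(e^{i\theta})=\kappa(\{e^{i\varphi}: x_1<\varphi<\theta\}),\qquad x_1\le\theta<x_1+2\pi.$$ A Dirichlet data point is a $z$ with $|z|=1$ for which $\binom11$ is an eigenvector of $T_p(z)$. Then: 1. For each $j=1,\dots,p$ there is exactly one $\theta\in[y_j,x_{j+1}]$ such that $z_j=e^{i\theta}$ is a Dirichlet data point, and there are no Dirichlet data points other than $z_1,\dots,z_p$. 2. For every $m\ge1$ and all $k\in\{1,\dots,p\}$, $q\in\{1,\dots,m-1\}$ there is exactly one $\theta\in[x_1,x_1+2\pi)$ with $$k(e^{i\theta})=\frac{k-1}p+\frac q{mp},$$ and it satisfies $x_k<\theta<y_k$. 3. For every $m\ge1$ the zeros in $\mathbb C$ of $\Phi_{mp}-\Phi_{mp}^*$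 are exactly the $p$ Dirichlet data points from 1 and the $(m-1)p$ points $e^{i\theta}$ from 2. There are $mp$ zeros counting multiplicity, and all of them are simple. -/

import Mathlib

open Polynomial

namespace PeriodicOPUC

noncomputable section

/-- The reversal `P ↦ P^*` of degree `n`, `P^*(z) = z ^ n * conj (P (1 / conj z))`, for a
polynomial `P` of degree at most `n`: conjugate the coefficients and reverse their order. -/
def reversal (n : ℕ) (P : ℂ[X]) : ℂ[X] :=
  (P.map (starRingEnd ℂ)).reflect n

/-- The monic orthogonal polynomials `Φ_n` on the unit circle with Verblunsky coefficients `α`: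
`Φ_0 = 1` and `Φ_{n+1}(z) = z Φ_n(z) - conj (α_n) Φ_n^*(z)`. -/
def Phi (α : ℕ → ℂ) : ℕ → ℂ[X]
  | 0 => 1
  | n + 1 => X * Phi α n - C (starRingEnd ℂ (α n)) * reversal n (Phi α n)

/-- `Φ_n^*`. -/
def PhiStar (α : ℕ → ℂ) (n : ℕ) : ℂ[X] :=
  reversal n (Phi α n)

/-- `ρ_n = (1 - |α_n|^2)^{1/2}`. -/
def rho (α : ℕ → ℂ) (n : ℕ) : ℝ :=
  Real.sqrt (1 - ‖α n‖ ^ 2)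

/-- The one-step transfer matrix `A_n(z)`. -/
def stepMatrix (α : ℕ → ℂ) (n : ℕ) (z : ℂ) : Matrix (Fin 2) (Fin 2) ℂ :=
  ((rho α n : ℂ))⁻¹ • !![z, -(starRingEnd ℂ (α n)); -(z * α n), 1]

/-- The transfer matrix `T_n(z) = A_{n-1}(z) ⋯ A_0(z)`. -/
def transferMatrix (α : ℕ → ℂ) : ℕ → ℂ → Matrix (Fin 2) (Fin 2) ℂ
  | 0, _ => 1
  | n + 1, z => stepMatrix α n z * transferMatrix α n z

/-- The discriminant `Δ(z) = z^{-p/2} Tr T_p(z)`; it is used for even `p` and `z ≠ 0`. -/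
def discriminant (α : ℕ → ℂ) (p : ℕ) (z : ℂ) : ℂ :=
  (z ^ (p / 2))⁻¹ * (transferMatrix α p z).trace

/-- The point `e^{iθ}`. -/
def circlePt (θ : ℝ) : ℂ :=
  Complex.exp (θ * Complex.I)

/-- The union of the bands: the points of the unit circle where `Δ(z) ∈ [-2, 2]`. -/
def bandSet (α : ℕ → ℂ) (p : ℕ) : Set ℂ :=
  {z | ‖z‖ = 1 ∧ ∃ t ∈ Set.Icc (-2 : ℝ) 2, discriminant α p z = (t : ℂ)}

/-- `x_1 < y_1 ≤ x_2 < y_2 ≤ ⋯ < y_p ≤ x_{p+1} = x_1 + 2π` is a labelling of the band edges: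
the `j`-th band is `{e^{iθ} | x_j ≤ θ ≤ y_j}` and the `j`-th gap is
`{e^{iθ} | y_j < θ < x_{j+1}}`, which is empty (a closed gap) if `y_j = x_{j+1}`.
Only the values `x_1, …, x_{p+1}` and `y_1, …, y_p` matter. -/
structure IsBandEdges (α : ℕ → ℂ) (p : ℕ) (x y : ℕ → ℝ) : Prop where
  start : x 1 ∈ Set.Ico 0 (2 * Real.pi)
  wrap : x (p + 1) = x 1 + 2 * Real.pi
  band_lt : ∀ j ∈ Set.Icc 1 p, x j < y j
  gap_le : ∀ j ∈ Set.Icc 1 p, y j ≤ x (j + 1)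
  /-- the edges are solutions of `Δ = ±2` -/
  edge_left : ∀ j ∈ Set.Icc 1 p,
    discriminant α p (circlePt (x j)) = 2 ∨ discriminant α p (circlePt (x j)) = -2
  edge_right : ∀ j ∈ Set.Icc 1 p,
    discriminant α p (circlePt (y j)) = 2 ∨ discriminant α p (circlePt (y j)) = -2
  /-- there are no solutions of `Δ = ±2` inside a band -/
  interior : ∀ j ∈ Set.Icc 1 p, ∀ θ ∈ Set.Ioo (x j) (y j),
    discriminant α p (circlePt θ) ≠ 2 ∧ discriminant α p (circlePt θ) ≠ -2
  /-- the bands together are precisely the points where `Δ ∈ [-2, 2]` -/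
  union : (⋃ j ∈ Set.Icc 1 p, circlePt '' Set.Icc (x j) (y j)) = bandSet α p

/-- `z` (on the unit circle) is a Dirichlet data point of the period `p` problem: the vector
`(1, 1)` is an eigenvector of `T_p(z)`. -/
def IsDirichletPoint (α : ℕ → ℂ) (p : ℕ) (z : ℂ) : Prop :=
  ‖z‖ = 1 ∧ ∃ c : ℂ, (transferMatrix α p z).mulVec ![1, 1] = c • ![1, 1]

/-- The logarithmic energy `∬ log (1 / |z - w|) dμ(z) dμ(w)`, as the difference of the integrals of
the positive and the negative part of the kernel, which is `+∞` for `z = w`. If `μ` is finite and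
carried by a bounded set, then the second integral is finite. -/
def logEnergy (μ : MeasureTheory.Measure ℂ) : EReal :=
  ((∫⁻ z, ∫⁻ w, (-(ENNReal.log (edist z w))).toENNReal ∂μ ∂μ : ENNReal) : EReal)
    - ((∫⁻ z, ∫⁻ w, (ENNReal.log (edist z w)).toENNReal ∂μ ∂μ : ENNReal) : EReal)

/-- `κ` is the potential-theoretic equilibrium measure of the compact set `K`: a probability
measure on `K` with finite logarithmic energy, minimal among all probability measures on `K`. -/
structure IsEquilibriumMeasure (K : Set ℂ) (κ : MeasureTheory.Measure ℂ) : Prop where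
  prob : MeasureTheory.IsProbabilityMeasure κ
  carried : κ Kᶜ = 0
  finite_energy : logEnergy κ < ⊤
  minimal : ∀ μ : MeasureTheory.Measure ℂ, MeasureTheory.IsProbabilityMeasure μ → μ Kᶜ = 0 →
    logEnergy κ ≤ logEnergy μ

/-- `k(e^{iθ})`, the `κ`-measure of the open arc from `e^{i x₁}` to `e^{iθ}`,
for `x₁ ≤ θ < x₁ + 2π`. -/
def arcMass (κ : MeasureTheory.Measure ℂ) (x₁ θ : ℝ) : ℝ :=
  κ.real (circlePt '' Set.Ioo x₁ θ)

end

end PeriodicOPUC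

/-!
Why the theorem is true.

On the unit circle, `z = e^{iθ}`, the normalised transfer matrix `e^{-ipθ/2} T_p(z)` has the form
`!![u, v; conj v, conj u]` and lies in `SU(1,1)`, so that `Δ = 2 Re u` is real. Its logarithmic
derivative in `θ` stays in the interior of the positive cone of the Lie algebra
(`hasDerivAt_suPair`); hence, where `|Δ| < 2`, one has `|v| < |Im u|`, and `Δ'` does not vanish
and has the sign of `-Im u` (`exists_hasDerivAt_realDisc`). So `Δ` is strictly monotone on each
interval where `|Δ| < 2`. Off the circle `T_p(z)` moves the form `|a|^2 - |b|^2` strictly in one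
direction, which forces the `p` zeros of `Δ` to lie on the circle, and there they are simple
(`levelPoly_zero_roots`). Each of them is contained in exactly one band (`exists_isBandSystem`).
For `-2 < c < 2` each of the `p` bands contains a solution of `Δ = c`, and as `z^{p/2} (Δ(z) - c)`
is a polynomial of degree `p` this gives the product formula `levelPoly_eval_eq_prod`. By
continuity in `c` the bands exhaust the set where `Δ ∈ [-2, 2]`.

Dirichlet data points are the zeros of `Im (u + v)`, which has the sign of `Im u` on the bands.
Since `Δ` takes the same value at both ends of a gap, it increases on one of the neighbouring
bands and decreases on the other, so `Im (u + v)` changes its sign across the gap and has a zero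
there (`exists_dirichletFun_eq_zero`).

The equilibrium measure is the pullback under `Δ` of the arcsine distribution of `[-2, 2]`
(`bandMeasure`): by the product formula its potential on the bands is constant, because the
potential of the arcsine distribution vanishes on `[-2, 2]` (`bandMeasure_potential`). That such a
measure is the unique minimiser of the energy follows from the Fourier expansion
`-log |1 - e^{it}| = ∑ cos (n t) / n`, by which the energy of a difference of two probability measures on the
circle is `∑ |moment difference|^2 / n`; the expansion is used in its Abel-regularised form
(`moment_sub_sq_le_energy`, `isEquilibriumMeasure_iff_of_potential`). On the `k`-th band,
`Δ = ± 2 cos (p π (k(e^{iθ}) - (k - 1) / p))`.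

Finally `(Φ_n, Φ_n^*)` is a multiple of `T_n (1, 1)`, and `T_{mp} = T_p^m`. So `Φ_{mp} - Φ_{mp}^*`
vanishes at the Dirichlet points, and, by the Chebyshev recursion for the powers of a matrix of
determinant one (`sin_smul_pow`), also where `Δ = 2 cos (r π / m)` with `0 < r < m`, as there
`T_p^m` is scalar. These are `p + (m - 1) p` different points, and `m p` is the degree, so there
are no other zeros and all are simple (`roots_phi_sub_phiStar`). The case `m = 1` shows that there
is just one Dirichlet point in each gap.
-/

namespace PeriodicOPUC

open scoped ComplexConjugate

/-! ### The normalised transfer matrix on the unit circle -/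

/-- The square root `e^{iθ/2}` of `e^{iθ}`. -/
noncomputable def halfPt (θ : ℝ) : ℂ := circlePt (θ / 2)

theorem norm_circlePt (θ : ℝ) : ‖circlePt θ‖ = 1 := by
  simp [circlePt]

theorem circlePt_ne_zero (θ : ℝ) : circlePt θ ≠ 0 := Complex.exp_ne_zero _

theorem halfPt_sq (θ : ℝ) : halfPt θ ^ 2 = circlePt θ := by
  rw [halfPt, circlePt, circlePt, ← Complex.exp_nat_mul]
  congr 1
  push_cast
  ring

theorem halfPt_mul_conj (θ : ℝ) : halfPt θ * conj (halfPt θ) = 1 := by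
  rw [Complex.mul_conj, Complex.normSq_eq_norm_sq, halfPt, norm_circlePt]
  norm_num

theorem hasDerivAt_halfPt (θ : ℝ) : HasDerivAt halfPt (halfPt θ * (Complex.I / 2)) θ := by
  have h1 : HasDerivAt (fun x : ℝ => ((x / 2 : ℝ) : ℂ) * Complex.I) (Complex.I / 2) θ := by
    have h := (((hasDerivAt_id θ).div_const 2).ofReal_comp).mul_const Complex.I
    have e : ((1 / 2 : ℝ) : ℂ) * Complex.I = Complex.I / 2 := by push_cast; ring
    rw [e] at h
    exact h
  exact h1.cexp

theorem circlePt_add_two_pi (θ : ℝ) : circlePt (θ + 2 * Real.pi) = circlePt θ := by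
  rw [circlePt, circlePt]
  push_cast
  rw [add_mul, Complex.exp_periodic]

theorem circlePt_eq_iff {θ φ : ℝ} :
    circlePt θ = circlePt φ ↔ ∃ n : ℤ, θ = φ + n * (2 * Real.pi) := by
  rw [circlePt, circlePt, Complex.exp_eq_exp_iff_exists_int]
  refine exists_congr fun n => ?_
  have : (φ : ℂ) * Complex.I + n * (2 * Real.pi * Complex.I)
      = ((φ + n * (2 * Real.pi) : ℝ) : ℂ) * Complex.I := by push_cast; ring
  rw [this]
  constructor
  · intro h
    exact_mod_cast mul_right_cancel₀ Complex.I_ne_zero h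
  · intro h
    rw [h]

theorem eq_of_circlePt_eq {θ φ : ℝ} (h : circlePt θ = circlePt φ)
    (hlt : |θ - φ| < 2 * Real.pi) : θ = φ := by
  obtain ⟨n, hn⟩ := circlePt_eq_iff.1 h
  have hpi := Real.pi_pos
  rw [abs_lt] at hlt
  have h1 : (n : ℝ) < 1 := by
    by_contra! hc
    nlinarith
  have h2 : (-1 : ℝ) < n := by
    by_contra! hc
    nlinarith
  have h3 : n = 0 := by
    have : n < 1 := by exact_mod_cast h1
    have : -1 < n := by exact_mod_cast h2
    omega
  simpa [h3] using hn

theorem exists_circlePt_eq {z : ℂ} (hz : ‖z‖ = 1) (a : ℝ) :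
    ∃ θ ∈ Set.Ico a (a + 2 * Real.pi), circlePt θ = z := by
  have h : circlePt z.arg = z := by
    have := Complex.norm_mul_exp_arg_mul_I z
    rw [hz] at this
    simpa [circlePt] using this
  refine ⟨toIcoMod Real.two_pi_pos a z.arg, toIcoMod_mem_Ico _ _ _, ?_⟩
  rw [← h, circlePt_eq_iff]
  refine ⟨-toIcoDiv Real.two_pi_pos a z.arg, ?_⟩
  have := toIcoMod_add_toIcoDiv_zsmul Real.two_pi_pos a z.arg
  rw [h, zsmul_eq_mul] at *
  push_cast
  linarith

theorem continuous_circlePt : Continuous circlePt := by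
  unfold circlePt
  fun_prop

/-- The first row `(u_n, v_n)` of the normalised transfer matrix `e^{-inθ/2} T_n(e^{iθ})`, whose
second row is `(conj v_n, conj u_n)`. -/
noncomputable def suPair (α : ℕ → ℂ) : ℕ → ℝ → ℂ × ℂ
  | 0, _ => (1, 0)
  | n + 1, θ =>
    ((rho α n : ℂ)⁻¹ * (halfPt θ * (suPair α n θ).1
        - conj (α n) * conj (halfPt θ) * conj (suPair α n θ).2),
     (rho α n : ℂ)⁻¹ * (halfPt θ * (suPair α n θ).2
        - conj (α n) * conj (halfPt θ) * conj (suPair α n θ).1))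

theorem rho_pos {α : ℕ → ℂ} (hα : ∀ n, ‖α n‖ < 1) (n : ℕ) : 0 < rho α n := by
  have := hα n
  have h0 := norm_nonneg (α n)
  exact Real.sqrt_pos.2 (by nlinarith)

theorem rho_sq {α : ℕ → ℂ} (hα : ∀ n, ‖α n‖ < 1) (n : ℕ) :
    (rho α n : ℂ) ^ 2 = 1 - α n * conj (α n) := by
  have := hα n
  have h0 := norm_nonneg (α n)
  rw [Complex.mul_conj, Complex.normSq_eq_norm_sq, rho]
  norm_cast
  rw [Real.sq_sqrt (by nlinarith)]

theorem rho_inv_sq {α : ℕ → ℂ} (hα : ∀ n, ‖α n‖ < 1) (n : ℕ) :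
    ((rho α n : ℂ)⁻¹) ^ 2 * (1 - α n * conj (α n)) = 1 := by
  rw [← rho_sq hα, ← mul_pow, inv_mul_cancel₀, one_pow]
  exact_mod_cast (rho_pos hα n).ne'

theorem transferMatrix_circlePt (α : ℕ → ℂ) (n : ℕ) (θ : ℝ) :
    transferMatrix α n (circlePt θ) = halfPt θ ^ n •
      !![(suPair α n θ).1, (suPair α n θ).2;
        conj (suPair α n θ).2, conj (suPair α n θ).1] := by
  induction n with
  | zero => ext i j; fin_cases i <;> fin_cases j <;> simp [transferMatrix, suPair]
  | succ n ih =>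
    have he := halfPt_mul_conj θ
    rw [transferMatrix, ih, stepMatrix, ← halfPt_sq]
    ext i j
    fin_cases i <;> fin_cases j <;> simp [suPair, Matrix.mul_apply, Fin.sum_univ_two]
    · linear_combination ((rho α n : ℂ)⁻¹ * halfPt θ ^ n * conj (α n)
        * conj (suPair α n θ).2) * he
    · linear_combination ((rho α n : ℂ)⁻¹ * halfPt θ ^ n * conj (α n)
        * conj (suPair α n θ).1) * he
    · linear_combination (-(rho α n : ℂ)⁻¹ * halfPt θ ^ n * conj (suPair α n θ).2) * he
    · linear_combination (-(rho α n : ℂ)⁻¹ * halfPt θ ^ n * conj (suPair α n θ).1) * he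

theorem suPair_det {α : ℕ → ℂ} (hα : ∀ n, ‖α n‖ < 1) (n : ℕ) (θ : ℝ) :
    (suPair α n θ).1 * conj (suPair α n θ).1 - (suPair α n θ).2 * conj (suPair α n θ).2 = 1 := by
  induction n with
  | zero => simp [suPair]
  | succ n ih =>
    have he := halfPt_mul_conj θ
    have hr := rho_inv_sq hα n
    simp only [suPair, map_mul, map_sub, Complex.conj_conj, map_inv₀, Complex.conj_ofReal]
    linear_combination ((rho α n : ℂ)⁻¹ ^ 2 * (halfPt θ * conj (halfPt θ)) *
      (1 - α n * conj (α n))) * ih + ((rho α n : ℂ)⁻¹ ^ 2 * (1 - α n * conj (α n))) * he + hr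

theorem suPair_norm_sq {α : ℕ → ℂ} (hα : ∀ n, ‖α n‖ < 1) (n : ℕ) (θ : ℝ) :
    ‖(suPair α n θ).1‖ ^ 2 - ‖(suPair α n θ).2‖ ^ 2 = 1 := by
  have h := suPair_det hα n θ
  rw [Complex.mul_conj, Complex.mul_conj, Complex.normSq_eq_norm_sq,
    Complex.normSq_eq_norm_sq] at h
  exact_mod_cast h

/-- The logarithmic derivative `N⁻¹ N'` of the normalised transfer matrix `N` is
`!![i a, b; conj b, -i a]` with `|b| ≤ a`: each step contributes the conjugate of
`(i / 2) diag (1, -1)` by an element of `SU(1,1)`, and such matrices form a convex cone. -/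
theorem hasDerivAt_suPair {α : ℕ → ℂ} (hα : ∀ n, ‖α n‖ < 1) (n : ℕ) (θ : ℝ) :
    ∃ (a : ℝ) (b : ℂ), ‖b‖ ≤ a ∧ (0 < n → ‖b‖ < a) ∧
      HasDerivAt (fun θ => (suPair α n θ).1)
        ((suPair α n θ).1 * (a * Complex.I) + (suPair α n θ).2 * conj b) θ ∧
      HasDerivAt (fun θ => (suPair α n θ).2)
        ((suPair α n θ).1 * b - (suPair α n θ).2 * (a * Complex.I)) θ := by
  induction n with
  | zero =>
    refine ⟨0, 0, by simp, by simp, ?_, ?_⟩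
    · simpa [suPair] using hasDerivAt_const θ (1 : ℂ)
    · simpa [suPair] using hasDerivAt_const θ (0 : ℂ)
  | succ n ih =>
    obtain ⟨a, b, hab, -, hu, hv⟩ := ih
    set u := (suPair α n θ).1 with hu_def
    set v := (suPair α n θ).2 with hv_def
    have hdet := suPair_det hα n θ
    have hnorm := suPair_norm_sq hα n θ
    rw [← hu_def, ← hv_def] at hdet hnorm
    have he := hasDerivAt_halfPt θ
    have hlt : ‖b + Complex.I * conj u * v‖ < a + (‖u‖ ^ 2 + ‖v‖ ^ 2) / 2 := by
      have h1 : ‖Complex.I * conj u * v‖ = ‖u‖ * ‖v‖ := by simp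
      have h2 := norm_add_le b (Complex.I * conj u * v)
      have h3 : 0 < (‖u‖ - ‖v‖) ^ 2 := by
        have : ‖u‖ - ‖v‖ ≠ 0 := by
          intro h
          have : ‖u‖ = ‖v‖ := by linarith
          rw [this] at hnorm
          linarith
        positivity
      nlinarith
    have hsum : (((‖u‖ ^ 2 + ‖v‖ ^ 2) / 2 : ℝ) : ℂ) = (u * conj u + v * conj v) / 2 := by
      rw [Complex.mul_conj, Complex.mul_conj, Complex.normSq_eq_norm_sq,
        Complex.normSq_eq_norm_sq]
      push_cast
      ring
    refine ⟨a + (‖u‖ ^ 2 + ‖v‖ ^ 2) / 2, b + Complex.I * conj u * v, hlt.le, fun _ => hlt, ?_, ?_⟩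
    · have h := ((he.mul hu).sub ((he.star.const_mul (conj (α n))).mul hv.star)).const_mul
        (rho α n : ℂ)⁻¹
      refine h.congr_deriv ?_
      simp only [suPair, map_mul, map_add, map_sub, Complex.conj_conj, Complex.conj_I,
        Complex.ofReal_add, hsum, Complex.star_def, Complex.conj_ofReal, map_div₀, Complex.conj_ofNat,
        ← hu_def, ← hv_def]
      linear_combination (-(rho α n : ℂ)⁻¹ * Complex.I / 2 *
        (halfPt θ * u + conj (α n) * conj (halfPt θ) * conj v)) * hdet
    · have h := ((he.mul hv).sub ((he.star.const_mul (conj (α n))).mul hu.star)).const_mul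
        (rho α n : ℂ)⁻¹
      refine h.congr_deriv ?_
      simp only [suPair, map_mul, map_add, Complex.conj_conj, Complex.conj_I,
        Complex.ofReal_add, hsum, Complex.star_def, Complex.conj_ofReal, map_div₀, Complex.conj_ofNat,
        ← hu_def, ← hv_def]
      linear_combination (-(rho α n : ℂ)⁻¹ * Complex.I / 2 *
        (halfPt θ * v + conj (α n) * conj (halfPt θ) * conj u)) * hdet

/-- The discriminant on the unit circle as a real function of the angle. -/
noncomputable def realDisc (α : ℕ → ℂ) (p : ℕ) (θ : ℝ) : ℝ := 2 * (suPair α p θ).1.re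

theorem halfPt_pow_even {p : ℕ} (hp : Even p) (θ : ℝ) : halfPt θ ^ p = circlePt θ ^ (p / 2) := by
  rw [← halfPt_sq, ← pow_mul, Nat.two_mul_div_two_of_even hp]

theorem discriminant_circlePt (α : ℕ → ℂ) {p : ℕ} (hp : Even p) (θ : ℝ) :
    discriminant α p (circlePt θ) = realDisc α p θ := by
  rw [discriminant, transferMatrix_circlePt, ← halfPt_pow_even hp, Matrix.trace_smul, smul_eq_mul,
    ← mul_assoc, inv_mul_cancel₀ (a := halfPt θ ^ p) (pow_ne_zero _ (circlePt_ne_zero _)), one_mul,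
    Matrix.trace_fin_two_of, Complex.add_conj, realDisc]

theorem suPair_add_two_pi (α : ℕ → ℂ) {p : ℕ} (hp : Even p) (θ : ℝ) :
    suPair α p (θ + 2 * Real.pi) = suPair α p θ := by
  have h1 := transferMatrix_circlePt α p θ
  have h2 := transferMatrix_circlePt α p (θ + 2 * Real.pi)
  rw [circlePt_add_two_pi, h1, halfPt_pow_even hp, halfPt_pow_even hp, circlePt_add_two_pi] at h2
  have h3 := smul_right_injective _ (pow_ne_zero (p / 2) (circlePt_ne_zero θ)) h2
  have h4 := congrFun (congrFun h3 0) 0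
  have h5 := congrFun (congrFun h3 0) 1
  simp only [Matrix.of_apply, Matrix.cons_val_zero, Matrix.cons_val_one] at h4 h5
  exact Prod.ext h4.symm h5.symm

theorem realDisc_add_two_pi (α : ℕ → ℂ) {p : ℕ} (hp : Even p) (θ : ℝ) :
    realDisc α p (θ + 2 * Real.pi) = realDisc α p θ := by
  rw [realDisc, realDisc, suPair_add_two_pi α hp]

theorem continuous_suPair_fst {α : ℕ → ℂ} (hα : ∀ n, ‖α n‖ < 1) (n : ℕ) :
    Continuous fun θ => (suPair α n θ).1 :=
  continuous_iff_continuousAt.2 fun θ => by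
    obtain ⟨a, b, -, -, h, -⟩ := hasDerivAt_suPair hα n θ
    exact h.continuousAt

theorem continuous_suPair_snd {α : ℕ → ℂ} (hα : ∀ n, ‖α n‖ < 1) (n : ℕ) :
    Continuous fun θ => (suPair α n θ).2 :=
  continuous_iff_continuousAt.2 fun θ => by
    obtain ⟨a, b, -, -, -, h⟩ := hasDerivAt_suPair hα n θ
    exact h.continuousAt

theorem continuous_realDisc {α : ℕ → ℂ} (hα : ∀ n, ‖α n‖ < 1) (n : ℕ) :
    Continuous (realDisc α n) := by
  have := continuous_suPair_fst hα n
  unfold realDisc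
  fun_prop

theorem norm_lt_abs_im {α : ℕ → ℂ} (hα : ∀ n, ‖α n‖ < 1) {n : ℕ} {θ : ℝ}
    (h : |realDisc α n θ| < 2) : ‖(suPair α n θ).2‖ < |(suPair α n θ).1.im| := by
  have h1 := suPair_norm_sq hα n θ
  rw [← Complex.normSq_eq_norm_sq, Complex.normSq_apply] at h1
  rw [realDisc, abs_lt] at h
  rw [← abs_of_nonneg (norm_nonneg _), ← sq_lt_sq]
  nlinarith

/-- Krein monotonicity: where `|Δ| < 2` the derivative of `Δ` has the sign of `-Im u`. -/
theorem exists_hasDerivAt_realDisc {α : ℕ → ℂ} (hα : ∀ n, ‖α n‖ < 1) {n : ℕ} (hn : 0 < n) {θ : ℝ}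
    (h : |realDisc α n θ| < 2) :
    ∃ d : ℝ, HasDerivAt (realDisc α n) d θ ∧ d * (suPair α n θ).1.im < 0 := by
  obtain ⟨a, b, -, hab, hu, -⟩ := hasDerivAt_suPair hα n θ
  have hab := hab hn
  have hlt := norm_lt_abs_im hα h
  have h1 := (Complex.reCLM.hasFDerivAt.comp_hasDerivAt θ hu).const_mul 2
  refine ⟨_, h1, ?_⟩
  set u := (suPair α n θ).1
  set v := (suPair α n θ).2
  have h2 : (u * (a * Complex.I) + v * conj b).re = -(a * u.im) + (v * conj b).re := by
    simp
    ring
  have h3 : |(v * conj b).re| ≤ ‖v‖ * ‖b‖ := by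
    simpa using Complex.abs_re_le_norm (v * conj b)
  rw [Complex.reCLM_apply, h2]
  have h4 : (v * conj b).re * u.im < a * u.im ^ 2 := by
    have hpos : 0 < |u.im| := (norm_nonneg _).trans_lt hlt
    have : ‖v‖ * ‖b‖ < |u.im| * a := mul_lt_mul'' hlt hab (norm_nonneg _) (norm_nonneg _)
    calc (v * conj b).re * u.im ≤ |(v * conj b).re * u.im| := le_abs_self _
      _ = |(v * conj b).re| * |u.im| := abs_mul _ _
      _ < |u.im| * a * |u.im| := mul_lt_mul_of_pos_right (h3.trans_lt this) hpos
      _ = a * |u.im| ^ 2 := by ring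
      _ = a * u.im ^ 2 := by rw [sq_abs]
  nlinarith

/-- The function `Im (u + v)` of the angle, whose zeros are the Dirichlet data points: the two
entries of the normalised transfer matrix applied to `(1, 1)` are `u + v` and its conjugate. -/
noncomputable def dirichletFun (α : ℕ → ℂ) (p : ℕ) (θ : ℝ) : ℝ :=
  (suPair α p θ).1.im + (suPair α p θ).2.im

theorem isDirichletPoint_circlePt_iff (α : ℕ → ℂ) (p : ℕ) (θ : ℝ) :
    IsDirichletPoint α p (circlePt θ) ↔ dirichletFun α p θ = 0 := by
  have hw : halfPt θ ^ p ≠ 0 := pow_ne_zero _ (circlePt_ne_zero _)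
  rw [IsDirichletPoint, transferMatrix_circlePt, dirichletFun]
  set u := (suPair α p θ).1
  set v := (suPair α p θ).2
  constructor
  · rintro ⟨-, c, hc⟩
    have h0 := congrFun hc 0
    have h1 := congrFun hc 1
    simp [Matrix.mulVec, dotProduct, Fin.sum_univ_two] at h0 h1
    rw [← h0, ← mul_add, ← mul_add] at h1
    have h2 := congrArg Complex.im (mul_left_cancel₀ hw h1)
    simp at h2
    linarith
  · intro h
    refine ⟨norm_circlePt θ, halfPt θ ^ p * (u + v), ?_⟩
    have h3 : conj v + conj u = u + v := by
      apply Complex.ext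
      · simp [add_comm]
      · simp; linarith
    ext i
    fin_cases i
    · simp [Matrix.mulVec, dotProduct, Fin.sum_univ_two]
      ring
    · simp [Matrix.mulVec, dotProduct, Fin.sum_univ_two]
      rw [← mul_add, h3]

theorem continuous_dirichletFun {α : ℕ → ℂ} (hα : ∀ n, ‖α n‖ < 1) (n : ℕ) :
    Continuous (dirichletFun α n) := by
  have := continuous_suPair_fst hα n
  have := continuous_suPair_snd hα n
  unfold dirichletFun
  fun_prop

theorem dirichletFun_mul_im_pos {α : ℕ → ℂ} (hα : ∀ n, ‖α n‖ < 1) {n : ℕ} {θ : ℝ}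
    (h : |realDisc α n θ| < 2) : 0 < dirichletFun α n θ * (suPair α n θ).1.im := by
  have h1 := norm_lt_abs_im hα h
  have h2 := (Complex.abs_im_le_norm (suPair α n θ).2).trans_lt h1
  rw [dirichletFun]
  set a := (suPair α n θ).1.im
  set b := (suPair α n θ).2.im
  have : 0 < |a| := (abs_nonneg _).trans_lt h2
  have h3 : |b * a| < a ^ 2 := by
    rw [abs_mul, ← sq_abs a, sq]
    exact mul_lt_mul_of_pos_right h2 this
  have := (abs_lt.1 h3).1
  nlinarith

/-! ### Transfer matrices with polynomial entries -/

/-- `ρ_0 ⋯ ρ_{n-1} T_n`, with polynomial entries. -/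
noncomputable def polyTransfer (α : ℕ → ℂ) : ℕ → Matrix (Fin 2) (Fin 2) ℂ[X]
  | 0 => 1
  | n + 1 => !![X, -C (conj (α n)); -(X * C (α n)), 1] * polyTransfer α n

/-- `ρ_0 ⋯ ρ_{n-1}`. -/
noncomputable def rhoProd (α : ℕ → ℂ) (n : ℕ) : ℝ := ∏ i ∈ Finset.range n, rho α i

theorem rhoProd_pos {α : ℕ → ℂ} (hα : ∀ n, ‖α n‖ < 1) (n : ℕ) : 0 < rhoProd α n :=
  Finset.prod_pos fun i _ => rho_pos hα i

theorem polyTransfer_succ_zero (α : ℕ → ℂ) (n : ℕ) (j : Fin 2) :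
    polyTransfer α (n + 1) 0 j =
      X * polyTransfer α n 0 j - C (conj (α n)) * polyTransfer α n 1 j := by
  rw [polyTransfer, Matrix.mul_apply, Fin.sum_univ_two]
  simp [sub_eq_add_neg]

theorem polyTransfer_succ_one (α : ℕ → ℂ) (n : ℕ) (j : Fin 2) :
    polyTransfer α (n + 1) 1 j =
      polyTransfer α n 1 j - C (α n) * (X * polyTransfer α n 0 j) := by
  rw [polyTransfer, Matrix.mul_apply, Fin.sum_univ_two]
  simp only [Matrix.of_apply, Matrix.cons_val_zero, Matrix.cons_val_one]
  ring

theorem transferMatrix_succ_zero (α : ℕ → ℂ) (n : ℕ) (z : ℂ) (j : Fin 2) :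
    transferMatrix α (n + 1) z 0 j = (rho α n : ℂ)⁻¹ *
      (z * transferMatrix α n z 0 j - conj (α n) * transferMatrix α n z 1 j) := by
  rw [transferMatrix, Matrix.mul_apply, Fin.sum_univ_two, stepMatrix]
  simp
  ring

theorem transferMatrix_succ_one (α : ℕ → ℂ) (n : ℕ) (z : ℂ) (j : Fin 2) :
    transferMatrix α (n + 1) z 1 j = (rho α n : ℂ)⁻¹ *
      (transferMatrix α n z 1 j - α n * (z * transferMatrix α n z 0 j)) := by
  rw [transferMatrix, Matrix.mul_apply, Fin.sum_univ_two, stepMatrix]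
  simp
  ring

theorem rhoProd_succ_mul_inv {α : ℕ → ℂ} (hα : ∀ n, ‖α n‖ < 1) (n : ℕ) (x : ℂ) :
    (rhoProd α (n + 1) : ℂ) * ((rho α n : ℂ)⁻¹ * x) = rhoProd α n * x := by
  have hr : (rho α n : ℂ) ≠ 0 := by exact_mod_cast (rho_pos hα n).ne'
  rw [rhoProd, Finset.prod_range_succ, ← rhoProd]
  push_cast
  field_simp

theorem polyTransfer_eval {α : ℕ → ℂ} (hα : ∀ n, ‖α n‖ < 1) (n : ℕ) (z : ℂ) (i j : Fin 2) :
    (polyTransfer α n i j).eval z = rhoProd α n * transferMatrix α n z i j := by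
  induction n generalizing i with
  | zero => fin_cases i <;> fin_cases j <;> simp [polyTransfer, rhoProd, transferMatrix]
  | succ n ih =>
    fin_cases i
    · simp only [Fin.zero_eta, polyTransfer_succ_zero, transferMatrix_succ_zero,
        rhoProd_succ_mul_inv hα, eval_sub, eval_mul, eval_X, eval_C, ih]
      ring
    · simp only [Fin.mk_one, polyTransfer_succ_one, transferMatrix_succ_one,
        rhoProd_succ_mul_inv hα, eval_sub, eval_mul, eval_X, eval_C, ih]
      ring

theorem natDegree_X_mul_sub_C_mul_le {P Q : ℂ[X]} {n : ℕ} (hP : P.natDegree ≤ n)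
    (hQ : Q.natDegree ≤ n + 1) (c : ℂ) : (X * P - C c * Q).natDegree ≤ n + 1 := by
  have h1 : (X * P).natDegree ≤ 1 + n := natDegree_mul_le_of_le natDegree_X_le hP
  have h2 := (natDegree_C_mul_le c Q).trans hQ
  exact (natDegree_sub_le _ _).trans (max_le (by omega) h2)

theorem natDegree_sub_C_mul_X_mul_le {P Q : ℂ[X]} {n : ℕ} (hP : P.natDegree ≤ n)
    (hQ : Q.natDegree ≤ n + 1) (c : ℂ) : (Q - C c * (X * P)).natDegree ≤ n + 1 := by
  have h1 : (X * P).natDegree ≤ 1 + n := natDegree_mul_le_of_le natDegree_X_le hP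
  have h2 := natDegree_C_mul_le c (X * P)
  exact (natDegree_sub_le _ _).trans (max_le hQ (by omega))

theorem polyTransfer_natDegree_fst (α : ℕ → ℂ) (n : ℕ) :
    (polyTransfer α n 0 0).natDegree ≤ n ∧ (polyTransfer α n 0 0).coeff n = 1 ∧
      (polyTransfer α n 1 0).natDegree ≤ n := by
  induction n with
  | zero => simp [polyTransfer]
  | succ n ih =>
    obtain ⟨h1, h2, h3⟩ := ih
    rw [polyTransfer_succ_zero, polyTransfer_succ_one]
    refine ⟨natDegree_X_mul_sub_C_mul_le h1 (by omega) _, ?_,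
      natDegree_sub_C_mul_X_mul_le h1 (by omega) _⟩
    rw [coeff_sub, coeff_X_mul, h2, coeff_C_mul, coeff_eq_zero_of_natDegree_lt (by omega)]
    simp

theorem polyTransfer_natDegree_snd (α : ℕ → ℂ) (n : ℕ) :
    (polyTransfer α (n + 1) 0 1).natDegree ≤ n ∧ (polyTransfer α (n + 1) 1 1).natDegree ≤ n := by
  induction n with
  | zero => simp [polyTransfer]
  | succ n ih =>
    obtain ⟨h1, h2⟩ := ih
    rw [polyTransfer_succ_zero _ (n + 1), polyTransfer_succ_one _ (n + 1)]
    exact ⟨natDegree_X_mul_sub_C_mul_le h1 (by omega) _,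
      natDegree_sub_C_mul_X_mul_le h1 (by omega) _⟩

/-- The polynomial `ρ_0 ⋯ ρ_{p-1} (Tr T_p(z) - c z^{p/2})`, whose zeros on the unit circle are the
solutions of `Δ = c`. -/
noncomputable def levelPoly (α : ℕ → ℂ) (p : ℕ) (c : ℝ) : ℂ[X] :=
  (polyTransfer α p).trace - C ((c * rhoProd α p : ℝ) : ℂ) * X ^ (p / 2)

theorem levelPoly_natDegree_le_and_coeff (α : ℕ → ℂ) {p : ℕ} (hp : 0 < p) (c : ℝ) :
    (levelPoly α p c).natDegree ≤ p ∧ (levelPoly α p c).coeff p = 1 := by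
  obtain ⟨n, rfl⟩ : ∃ n, p = n + 1 := ⟨p - 1, by omega⟩
  obtain ⟨h1, h2, -⟩ := polyTransfer_natDegree_fst α (n + 1)
  obtain ⟨-, h3⟩ := polyTransfer_natDegree_snd α n
  rw [levelPoly, Matrix.trace_fin_two]
  constructor
  · have h4 : (C ((c * rhoProd α (n + 1) : ℝ) : ℂ) * X ^ ((n + 1) / 2)).natDegree ≤ n + 1 :=
      (natDegree_C_mul_X_pow_le _ _).trans (by omega)
    exact (natDegree_sub_le _ _).trans
      (max_le ((natDegree_add_le _ _).trans (max_le h1 (by omega))) h4)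
  · rw [coeff_sub, coeff_add, h2, coeff_eq_zero_of_natDegree_lt (p := polyTransfer α (n + 1) 1 1)
      (by omega), coeff_C_mul, coeff_X_pow, if_neg (by omega)]
    simp

theorem levelPoly_monic (α : ℕ → ℂ) {p : ℕ} (hp : 0 < p) (c : ℝ) : (levelPoly α p c).Monic :=
  monic_of_natDegree_le_of_coeff_eq_one p (levelPoly_natDegree_le_and_coeff α hp c).1
    (levelPoly_natDegree_le_and_coeff α hp c).2

theorem levelPoly_natDegree (α : ℕ → ℂ) {p : ℕ} (hp : 0 < p) (c : ℝ) :
    (levelPoly α p c).natDegree = p := by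
  obtain ⟨h1, h2⟩ := levelPoly_natDegree_le_and_coeff α hp c
  exact le_antisymm h1 (le_natDegree_of_ne_zero (by rw [h2]; exact one_ne_zero))

theorem levelPoly_eval {α : ℕ → ℂ} (hα : ∀ n, ‖α n‖ < 1) (p : ℕ) (c : ℝ) (z : ℂ) :
    (levelPoly α p c).eval z =
      rhoProd α p * ((transferMatrix α p z).trace - c * z ^ (p / 2)) := by
  rw [levelPoly, Matrix.trace_fin_two, eval_sub, eval_add, polyTransfer_eval hα,
    polyTransfer_eval hα, Matrix.trace_fin_two]
  simp
  ring

theorem levelPoly_eval_circlePt {α : ℕ → ℂ} (hα : ∀ n, ‖α n‖ < 1) {p : ℕ} (hp : Even p) (c : ℝ)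
    (θ : ℝ) : (levelPoly α p c).eval (circlePt θ) =
      circlePt θ ^ (p / 2) * ((rhoProd α p * (realDisc α p θ - c) : ℝ) : ℂ) := by
  have h := discriminant_circlePt α hp θ
  have hz : circlePt θ ^ (p / 2) ≠ 0 := pow_ne_zero _ (circlePt_ne_zero θ)
  rw [discriminant, inv_mul_eq_iff_eq_mul₀ hz] at h
  rw [levelPoly_eval hα, h]
  push_cast
  ring

theorem levelPoly_eval_circlePt_eq_zero_iff {α : ℕ → ℂ} (hα : ∀ n, ‖α n‖ < 1) {p : ℕ}
    (hp : Even p) (c : ℝ) (θ : ℝ) :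
    (levelPoly α p c).eval (circlePt θ) = 0 ↔ realDisc α p θ = c := by
  rw [levelPoly_eval_circlePt hα hp, mul_eq_zero, Complex.ofReal_eq_zero, mul_eq_zero, sub_eq_zero]
  simp [circlePt_ne_zero, (rhoProd_pos hα p).ne']

/-- A polynomial of degree at most `card ι` with zeros at `card ι` distinct points has no other
zeros, and all its zeros are simple. -/
theorem roots_eq_map_of_injective {ι : Type*} [Fintype ι] {P : ℂ[X]} (hP : P ≠ 0)
    (hdeg : P.natDegree ≤ Fintype.card ι) {w : ι → ℂ} (hw : Function.Injective w)
    (h0 : ∀ i, P.eval (w i) = 0) : P.roots = Finset.univ.val.map w := by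
  classical
  symm
  apply Multiset.eq_of_le_of_card_le
  · rw [Multiset.le_iff_subset (Multiset.Nodup.map hw Finset.univ.nodup)]
    intro z hz
    obtain ⟨i, -, rfl⟩ := Multiset.mem_map.1 hz
    exact (mem_roots hP).2 (h0 i)
  · rw [Multiset.card_map]
    exact (card_roots' P).trans hdeg

/-! ### Zeros of the discriminant -/

theorem transferMatrix_det {α : ℕ → ℂ} (hα : ∀ n, ‖α n‖ < 1) (n : ℕ) (z : ℂ) :
    (transferMatrix α n z).det = z ^ n := by
  induction n with
  | zero => simp [transferMatrix]
  | succ n ih =>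
    rw [transferMatrix, Matrix.det_mul, ih, stepMatrix, Matrix.det_smul, Matrix.det_fin_two_of,
      Fintype.card_fin, pow_succ]
    linear_combination (z * z ^ n) * rho_inv_sq hα n

theorem mul_self_eq_trace_smul_sub (M : Matrix (Fin 2) (Fin 2) ℂ) :
    M * M = M.trace • M - M.det • (1 : Matrix (Fin 2) (Fin 2) ℂ) := by
  ext i j
  fin_cases i <;> fin_cases j <;>
    simp [Matrix.mul_apply, Fin.sum_univ_two, Matrix.trace_fin_two, Matrix.det_fin_two] <;> ring

/-- The indefinite form `|a|^2 - |b|^2` preserved by `SU(1,1)`. -/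
noncomputable def indefForm (v : Fin 2 → ℂ) : ℝ := ‖v 0‖ ^ 2 - ‖v 1‖ ^ 2

theorem indefForm_smul (c : ℂ) (v : Fin 2 → ℂ) : indefForm (c • v) = ‖c‖ ^ 2 * indefForm v := by
  simp [indefForm, mul_pow]
  ring

theorem indefForm_stepMatrix {α : ℕ → ℂ} (hα : ∀ n, ‖α n‖ < 1) (n : ℕ) (z : ℂ) (v : Fin 2 → ℂ) :
    indefForm ((stepMatrix α n z).mulVec v) = ‖z‖ ^ 2 * ‖v 0‖ ^ 2 - ‖v 1‖ ^ 2 := by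
  have key : ∀ w : ℂ, ((‖w‖ ^ 2 : ℝ) : ℂ) = w * conj w := fun w => by
    rw [Complex.mul_conj, Complex.normSq_eq_norm_sq]
  have hr := rho_inv_sq hα n
  apply Complex.ofReal_injective
  simp only [indefForm, Complex.ofReal_sub, Complex.ofReal_mul, key]
  simp [stepMatrix, Matrix.mulVec, dotProduct, Fin.sum_univ_two]
  linear_combination (z * conj z * (v 0 * conj (v 0)) - v 1 * conj (v 1)) * hr

theorem indefForm_stepMatrix_gap {α : ℕ → ℂ} (hα : ∀ n, ‖α n‖ < 1) (n : ℕ) (z : ℂ)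
    (v : Fin 2 → ℂ) :
    (1 - ‖z‖) * (‖z‖ * indefForm v - indefForm ((stepMatrix α n z).mulVec v)) =
      (1 - ‖z‖) ^ 2 * (‖z‖ * ‖v 0‖ ^ 2 + ‖v 1‖ ^ 2) := by
  rw [indefForm_stepMatrix hα, indefForm]
  ring

theorem indefForm_transferMatrix_nonneg {α : ℕ → ℂ} (hα : ∀ n, ‖α n‖ < 1) (n : ℕ) (z : ℂ)
    (v : Fin 2 → ℂ) :
    0 ≤ (1 - ‖z‖) * (‖z‖ ^ n * indefForm v - indefForm ((transferMatrix α n z).mulVec v)) := by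
  induction n with
  | zero => simp [transferMatrix]
  | succ n ih =>
    have h := indefForm_stepMatrix_gap hα n z ((transferMatrix α n z).mulVec v)
    rw [Matrix.mulVec_mulVec] at h
    have h1 := mul_nonneg (norm_nonneg z) ih
    rw [transferMatrix]
    have h2 : 0 ≤ (1 - ‖z‖) ^ 2 * (‖z‖ * ‖(transferMatrix α n z).mulVec v 0‖ ^ 2
      + ‖(transferMatrix α n z).mulVec v 1‖ ^ 2) := by positivity
    rw [← h] at h2
    calc 0 ≤ _ := add_nonneg h1 h2
      _ = _ := by ring

/-- Off the unit circle, `T_n` moves the form `|a|^2 - |b|^2` strictly in one direction, relative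
to its effect on volume. -/
theorem indefForm_transferMatrix_pos {α : ℕ → ℂ} (hα : ∀ n, ‖α n‖ < 1) {n : ℕ} (hn : 0 < n) {z : ℂ}
    (hz0 : z ≠ 0) (hz1 : ‖z‖ ≠ 1) {v : Fin 2 → ℂ} (hv : v 0 ≠ 0) :
    0 < (1 - ‖z‖) * (‖z‖ ^ n * indefForm v - indefForm ((transferMatrix α n z).mulVec v)) := by
  have hz : 0 < ‖z‖ := norm_pos_iff.2 hz0
  have hz2 : 1 - ‖z‖ ≠ 0 := fun h => hz1 (by linarith)
  induction n, hn using Nat.le_induction with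
  | base =>
    have h := indefForm_stepMatrix_gap hα 0 z v
    have hv' : 0 < ‖v 0‖ := norm_pos_iff.2 hv
    have h1 : transferMatrix α 1 z = stepMatrix α 0 z := by simp [transferMatrix]
    simp only [Nat.succ_eq_add_one, zero_add]
    rw [h1, pow_one, h]
    positivity
  | succ n hn ih =>
    have h := indefForm_stepMatrix_gap hα n z ((transferMatrix α n z).mulVec v)
    rw [Matrix.mulVec_mulVec] at h
    have h1 := mul_pos hz ih
    rw [transferMatrix]
    have h2 : 0 ≤ (1 - ‖z‖) ^ 2 * (‖z‖ * ‖(transferMatrix α n z).mulVec v 0‖ ^ 2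
      + ‖(transferMatrix α n z).mulVec v 1‖ ^ 2) := by positivity
    rw [← h] at h2
    calc 0 < _ := add_pos_of_pos_of_nonneg h1 h2
      _ = _ := by ring

theorem trace_transferMatrix_zero {α : ℕ → ℂ} (hα : ∀ n, ‖α n‖ < 1) {n : ℕ} (hn : 0 < n) :
    (transferMatrix α n 0).trace ≠ 0 := by
  have h : ∀ n, transferMatrix α n 0 1 0 = 0 ∧ transferMatrix α n 0 1 1 ≠ 0 ∧
      (0 < n → transferMatrix α n 0 0 0 = 0) := by
    intro n
    induction n with
    | zero => simp [transferMatrix]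
    | succ n ih =>
      have hr : (rho α n : ℂ) ≠ 0 := by exact_mod_cast (rho_pos hα n).ne'
      simp [transferMatrix, stepMatrix, Matrix.mul_apply, Fin.sum_univ_two, ih, hr]
  rw [Matrix.trace_fin_two, (h n).2.2 hn, zero_add]
  exact (h n).2.1

theorem norm_eq_one_of_trace_eq_zero {α : ℕ → ℂ} (hα : ∀ n, ‖α n‖ < 1) {p : ℕ} (hp : 0 < p) {z : ℂ}
    (hz : (transferMatrix α p z).trace = 0) : ‖z‖ = 1 := by
  by_contra hz1
  have hz0 : z ≠ 0 := by
    rintro rfl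
    exact trace_transferMatrix_zero hα hp hz
  have hsq := mul_self_eq_trace_smul_sub (transferMatrix α p z)
  rw [hz, zero_smul, transferMatrix_det hα, zero_sub, ← neg_smul] at hsq
  have h1 := indefForm_transferMatrix_pos hα hp hz0 hz1 (v := ![1, 0]) (by simp)
  have h2 := indefForm_transferMatrix_nonneg hα p z ((transferMatrix α p z).mulVec ![1, 0])
  rw [Matrix.mulVec_mulVec, hsq, Matrix.smul_mulVec, Matrix.one_mulVec, indefForm_smul, norm_neg,
    norm_pow] at h2
  have h3 := mul_pos (pow_pos (norm_pos_iff.2 hz0) p) h1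
  nlinarith

/-- `Δ` has `p` zeros, they are simple and lie on the unit circle. -/
theorem levelPoly_zero_roots {α : ℕ → ℂ} (hα : ∀ n, ‖α n‖ < 1) {p : ℕ} (hp : 0 < p)
    (hpe : Even p) : (levelPoly α p 0).roots.Nodup ∧ (levelPoly α p 0).roots.card = p ∧
      ∀ z ∈ (levelPoly α p 0).roots, ‖z‖ = 1 := by
  have hne := (levelPoly_monic α hp 0).ne_zero
  have hcirc : ∀ z ∈ (levelPoly α p 0).roots, ‖z‖ = 1 := by
    intro z hz
    have h := (mem_roots hne).1 hz
    rw [IsRoot, levelPoly_eval hα] at h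
    apply norm_eq_one_of_trace_eq_zero hα hp
    have hr : (rhoProd α p : ℂ) ≠ 0 := by exact_mod_cast (rhoProd_pos hα p).ne'
    simpa [hr] using h
  refine ⟨?_, ?_, hcirc⟩
  · rw [Multiset.nodup_iff_count_le_one]
    intro z
    rw [count_roots]
    by_contra! hcount
    obtain ⟨hz, hz'⟩ := (one_lt_rootMultiplicity_iff_isRoot hne).1 hcount
    obtain ⟨θ, -, rfl⟩ := exists_circlePt_eq (hcirc z ((mem_roots hne).2 hz)) 0
    have hD := (levelPoly_eval_circlePt_eq_zero_iff hα hpe 0 θ).1 hz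
    obtain ⟨d, hd, hneg⟩ := exists_hasDerivAt_realDisc hα hp (θ := θ) (by rw [hD]; norm_num)
    have hc : HasDerivAt circlePt (circlePt θ * Complex.I) θ := by
      have h1 : HasDerivAt (fun x : ℝ => (x : ℂ) * Complex.I) Complex.I θ := by
        simpa using (hasDerivAt_id θ).ofReal_comp.mul_const Complex.I
      exact h1.cexp
    have h1 := ((levelPoly α p 0).hasDerivAt (circlePt θ)).comp θ hc
    have h2 := (hc.pow (p / 2)).mul (((hd.sub_const 0).const_mul (rhoProd α p)).ofReal_comp)
    have h3 : (fun x => eval x (levelPoly α p 0)) ∘ circlePt =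
        circlePt ^ (p / 2) * fun y => ((rhoProd α p * (realDisc α p y - 0) : ℝ) : ℂ) := by
      funext φ
      exact levelPoly_eval_circlePt hα hpe 0 φ
    rw [h3] at h1
    have h4 := h1.unique h2
    rw [show (derivative (levelPoly α p 0)).eval (circlePt θ) = 0 from hz', hD] at h4
    have hd0 : d ≠ 0 := by
      rintro rfl
      simp at hneg
    simp [circlePt_ne_zero, (rhoProd_pos hα p).ne', hd0] at h4
  · rw [splits_iff_card_roots.1 (IsAlgClosed.splits _), levelPoly_natDegree α hp]

/-! ### Orthogonal polynomials and powers of the transfer matrix -/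

theorem reversal_X_mul {n : ℕ} {P : ℂ[X]} (hP : P.natDegree ≤ n) :
    reversal (n + 1) (X * P) = reversal n P := by
  rw [reversal, reversal, Polynomial.map_mul, map_X, add_comm,
    reflect_mul _ _ natDegree_X_le (natDegree_map_le.trans hP), reflect_one_X, one_mul]

theorem reversal_reversal {n : ℕ} {P : ℂ[X]} (hP : P.natDegree ≤ n) :
    reversal (n + 1) (reversal n P) = X * P := by
  have h1 : (reversal n P).map (starRingEnd ℂ) = P.reflect n := by
    rw [reversal, ← reflect_map, map_map]
    congr 1
    convert Polynomial.map_id (p := P)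
    ext x
    simp
  have h2 : (P.reflect n).natDegree ≤ n := natDegree_reflect_le.trans (max_le le_rfl hP)
  rw [reversal, h1, ← one_mul (P.reflect n), add_comm, reflect_mul _ _ (by simp) h2,
    reflect_one, pow_one, reflect_reflect]

theorem reversal_sub (n : ℕ) (P Q : ℂ[X]) :
    reversal n (P - Q) = reversal n P - reversal n Q := by
  simp [reversal, reflect_sub]

theorem reversal_C_mul (n : ℕ) (c : ℂ) (P : ℂ[X]) :
    reversal n (C c * P) = C (conj c) * reversal n P := by
  simp [reversal, reflect_C_mul]

theorem polyTransfer_natDegree_row (α : ℕ → ℂ) (n : ℕ) :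
    (polyTransfer α n 0 0 + polyTransfer α n 0 1).natDegree ≤ n ∧
      (polyTransfer α n 1 0 + polyTransfer α n 1 1).natDegree ≤ n := by
  rcases n with - | n
  · simp [polyTransfer]
  · obtain ⟨h1, -, h2⟩ := polyTransfer_natDegree_fst α (n + 1)
    obtain ⟨h3, h4⟩ := polyTransfer_natDegree_snd α n
    exact ⟨(natDegree_add_le _ _).trans (max_le h1 (by omega)),
      (natDegree_add_le _ _).trans (max_le h2 (by omega))⟩

/-- `(Φ_n, Φ_n^*)` is `ρ_0 ⋯ ρ_{n-1} T_n` applied to `(1, 1)`. -/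
theorem phi_eq_polyTransfer (α : ℕ → ℂ) (n : ℕ) :
    Phi α n = polyTransfer α n 0 0 + polyTransfer α n 0 1 ∧
      PhiStar α n = polyTransfer α n 1 0 + polyTransfer α n 1 1 := by
  induction n with
  | zero =>
    constructor
    · simp [Phi, polyTransfer]
    · simp [PhiStar, reversal, Phi, polyTransfer]
  | succ n ih =>
    obtain ⟨h1, h2⟩ := ih
    have hdeg : (Phi α n).natDegree ≤ n := by
      rw [h1]
      exact (polyTransfer_natDegree_row α n).1
    have hs : PhiStar α (n + 1) = PhiStar α n - C (α n) * (X * Phi α n) := by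
      rw [PhiStar, Phi, reversal_sub, reversal_X_mul hdeg, reversal_C_mul, reversal_reversal hdeg,
        PhiStar, Complex.conj_conj]
    constructor
    · rw [Phi, ← PhiStar, h2, h1, polyTransfer_succ_zero, polyTransfer_succ_zero]
      ring
    · rw [hs, h1, h2, polyTransfer_succ_one, polyTransfer_succ_one]
      ring

theorem phi_sub_phiStar_natDegree_le (α : ℕ → ℂ) (n : ℕ) :
    (Phi α n - PhiStar α n).natDegree ≤ n := by
  rw [(phi_eq_polyTransfer α n).1, (phi_eq_polyTransfer α n).2]
  obtain ⟨h1, h2⟩ := polyTransfer_natDegree_row α n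
  exact (natDegree_sub_le _ _).trans (max_le h1 h2)

theorem phi_sub_phiStar_eval {α : ℕ → ℂ} (hα : ∀ n, ‖α n‖ < 1) (n : ℕ) (z : ℂ) :
    (Phi α n - PhiStar α n).eval z = rhoProd α n *
      ((transferMatrix α n z 0 0 + transferMatrix α n z 0 1) -
        (transferMatrix α n z 1 0 + transferMatrix α n z 1 1)) := by
  rw [(phi_eq_polyTransfer α n).1, (phi_eq_polyTransfer α n).2]
  simp only [eval_sub, eval_add, polyTransfer_eval hα]
  ring

theorem phi_sub_phiStar_ne_zero {α : ℕ → ℂ} (hα : ∀ n, ‖α n‖ < 1) {n : ℕ} (hn : 0 < n) :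
    Phi α n - PhiStar α n ≠ 0 := by
  have h1 : ∀ k, (PhiStar α k).eval 0 = 1 := by
    intro k
    rw [(phi_eq_polyTransfer α k).2]
    induction k with
    | zero => simp [polyTransfer]
    | succ k ih =>
      rw [polyTransfer_succ_one, polyTransfer_succ_one]
      simpa using ih
  obtain ⟨k, rfl⟩ : ∃ k, n = k + 1 := ⟨n - 1, by omega⟩
  have h2 : (Phi α (k + 1)).eval 0 = -conj (α k) := by
    rw [Phi, ← PhiStar]
    simp [h1]
  intro h
  have h3 := congrArg (Polynomial.eval 0) h
  rw [eval_sub, h1, h2, eval_zero, sub_eq_zero] at h3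
  have h4 := congrArg norm h3
  rw [norm_neg, Complex.norm_conj, norm_one] at h4
  exact (hα k).ne h4

theorem transferMatrix_add_period {α : ℕ → ℂ} {p : ℕ} (hper : ∀ n, α (n + p) = α n) (n : ℕ)
    (z : ℂ) : transferMatrix α (n + p) z = transferMatrix α n z * transferMatrix α p z := by
  induction n with
  | zero => simp [transferMatrix]
  | succ n ih =>
    have hs : stepMatrix α (n + p) z = stepMatrix α n z := by simp [stepMatrix, rho, hper]
    rw [show n + 1 + p = (n + p) + 1 by omega, transferMatrix, ih, hs, transferMatrix,
      Matrix.mul_assoc]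

theorem transferMatrix_mul_period {α : ℕ → ℂ} {p : ℕ} (hper : ∀ n, α (n + p) = α n) (m : ℕ)
    (z : ℂ) : transferMatrix α (m * p) z = transferMatrix α p z ^ m := by
  induction m with
  | zero => simp [transferMatrix]
  | succ m ih => rw [add_mul, one_mul, transferMatrix_add_period hper, ih, pow_succ]

theorem phi_sub_phiStar_eval_of_isDirichletPoint {α : ℕ → ℂ} (hα : ∀ n, ‖α n‖ < 1) {p : ℕ}
    (hper : ∀ n, α (n + p) = α n) (m : ℕ) {z : ℂ} (hz : IsDirichletPoint α p z) :
    (Phi α (m * p) - PhiStar α (m * p)).eval z = 0 := by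
  obtain ⟨-, c, hc⟩ := hz
  have h : ((transferMatrix α p z) ^ m).mulVec ![1, 1] = c ^ m • ![1, 1] := by
    induction m with
    | zero => simp
    | succ m ih => rw [pow_succ, ← Matrix.mulVec_mulVec, hc, Matrix.mulVec_smul, ih, smul_smul,
        pow_succ, mul_comm]
  rw [← transferMatrix_mul_period hper] at h
  have h0 := congrFun h 0
  have h1 := congrFun h 1
  simp [Matrix.mulVec, dotProduct, Fin.sum_univ_two] at h0 h1
  rw [phi_sub_phiStar_eval hα, h0, h1, sub_self, mul_zero]

/-- The Chebyshev recursion for the powers of a `2 × 2` matrix of determinant one. -/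
theorem sin_smul_pow {N : Matrix (Fin 2) (Fin 2) ℂ} {s : ℂ}
    (hN : N * N = (2 * Complex.cos s) • N - 1) (m : ℕ) :
    Complex.sin s • N ^ m = Complex.sin (m * s) • N
      - Complex.sin ((m - 1) * s) • (1 : Matrix (Fin 2) (Fin 2) ℂ) := by
  induction m with
  | zero => simp
  | succ m ih =>
    have h : Complex.sin ((m + 1) * s) = 2 * Complex.cos s * Complex.sin (m * s)
        - Complex.sin ((m - 1) * s) := by
      rw [add_mul, sub_mul, one_mul, Complex.sin_add, Complex.sin_sub]
      ring
    rw [pow_succ, ← Matrix.smul_mul, ih, Matrix.sub_mul, Matrix.smul_mul, hN, Matrix.smul_mul,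
      Matrix.one_mul]
    push_cast
    rw [h, add_sub_cancel_right]
    module

theorem phi_sub_phiStar_eval_of_realDisc {α : ℕ → ℂ} (hα : ∀ n, ‖α n‖ < 1) {p : ℕ}
    (hper : ∀ n, α (n + p) = α n) (m : ℕ) {θ s : ℝ} (hD : realDisc α p θ = 2 * Real.cos s)
    (hs : Real.sin s ≠ 0) (hms : Real.sin (m * s) = 0) :
    (Phi α (m * p) - PhiStar α (m * p)).eval (circlePt θ) = 0 := by
  set N : Matrix (Fin 2) (Fin 2) ℂ := !![(suPair α p θ).1, (suPair α p θ).2;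
        conj (suPair α p θ).2, conj (suPair α p θ).1] with hN
  have hNN : N * N = (2 * Complex.cos s) • N - 1 := by
    have hdet : N.det = 1 := by
      rw [hN, Matrix.det_fin_two_of]
      exact suPair_det hα p θ
    have htr : N.trace = 2 * Complex.cos s := by
      rw [hN, Matrix.trace_fin_two_of, Complex.add_conj]
      rw [realDisc] at hD
      rw [hD]
      push_cast
      rfl
    rw [mul_self_eq_trace_smul_sub, hdet, htr, one_smul]
  have h := sin_smul_pow hNN m
  have hms' : Complex.sin (m * s) = 0 := by exact_mod_cast congrArg Complex.ofReal hms
  have hs' : Complex.sin s ≠ 0 := by exact_mod_cast hs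
  rw [hms', zero_smul, zero_sub, ← neg_smul] at h
  have hpow : N ^ m = ((Complex.sin s)⁻¹ * -Complex.sin ((m - 1) * s)) •
      (1 : Matrix (Fin 2) (Fin 2) ℂ) := by
    rw [← smul_smul, ← h, smul_smul, inv_mul_cancel₀ hs', one_smul]
  rw [phi_sub_phiStar_eval hα, transferMatrix_mul_period hper, transferMatrix_circlePt, ← hN,
    _root_.smul_pow, hpow]
  simp

/-! ### Monotonicity of the discriminant on bands -/

theorem im_pos_or_im_neg {α : ℕ → ℂ} (hα : ∀ n, ‖α n‖ < 1) {p : ℕ} {a b : ℝ}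
    (h : ∀ θ ∈ Set.Ioo a b, |realDisc α p θ| < 2) :
    (∀ θ ∈ Set.Ioo a b, 0 < (suPair α p θ).1.im) ∨
      ∀ θ ∈ Set.Ioo a b, (suPair α p θ).1.im < 0 := by
  have hne : ∀ θ ∈ Set.Ioo a b, (suPair α p θ).1.im ≠ 0 := fun θ hθ h0 => by
    have := norm_lt_abs_im hα (h θ hθ)
    rw [h0, abs_zero] at this
    exact (norm_nonneg _).not_gt this
  have hc : Continuous fun θ => (suPair α p θ).1.im :=
    Complex.continuous_im.comp (continuous_suPair_fst hα p)
  by_contra! hcon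
  obtain ⟨⟨s, hs, hs'⟩, t, ht, ht'⟩ := hcon
  obtain ⟨r, hr, hr'⟩ := isPreconnected_Ioo.intermediate_value hs ht hc.continuousOn ⟨hs', ht'⟩
  exact hne r hr hr'

theorem strictMonoOn_or_strictAntiOn {α : ℕ → ℂ} (hα : ∀ n, ‖α n‖ < 1) {p : ℕ} (hp : 0 < p)
    {a b : ℝ} (h : ∀ θ ∈ Set.Ioo a b, |realDisc α p θ| < 2) :
    ((∀ θ ∈ Set.Ioo a b, 0 < (suPair α p θ).1.im) ∧
      StrictAntiOn (realDisc α p) (Set.Icc a b)) ∨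
    ((∀ θ ∈ Set.Ioo a b, (suPair α p θ).1.im < 0) ∧
      StrictMonoOn (realDisc α p) (Set.Icc a b)) := by
  refine (im_pos_or_im_neg hα h).imp (fun hs => ⟨hs, ?_⟩) fun hs => ⟨hs, ?_⟩
  · refine strictAntiOn_of_deriv_neg (convex_Icc a b) (continuous_realDisc hα p).continuousOn ?_
    intro θ hθ
    rw [interior_Icc] at hθ
    obtain ⟨d, hd, hneg⟩ := exists_hasDerivAt_realDisc hα hp (h θ hθ)
    rw [hd.deriv]
    nlinarith [hs θ hθ]
  · refine strictMonoOn_of_deriv_pos (convex_Icc a b) (continuous_realDisc hα p).continuousOn ?_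
    intro θ hθ
    rw [interior_Icc] at hθ
    obtain ⟨d, hd, hneg⟩ := exists_hasDerivAt_realDisc hα hp (h θ hθ)
    rw [hd.deriv]
    nlinarith [hs θ hθ]

theorem realDisc_injOn {α : ℕ → ℂ} (hα : ∀ n, ‖α n‖ < 1) {p : ℕ} (hp : 0 < p)
    {a b : ℝ} (h : ∀ θ ∈ Set.Ioo a b, |realDisc α p θ| < 2) :
    Set.InjOn (realDisc α p) (Set.Icc a b) := by
  rcases strictMonoOn_or_strictAntiOn hα hp h with ⟨-, h1⟩ | ⟨-, h1⟩
  · exact h1.injOn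
  · exact h1.injOn

/-- `[a, b]` is a maximal interval on which `|Δ| ≤ 2`, apart from closed gaps: `|Δ| < 2` inside
and `|Δ| = 2` at the ends. -/
structure IsBand (α : ℕ → ℂ) (p : ℕ) (a b : ℝ) : Prop where
  lt : a < b
  left : |realDisc α p a| = 2
  right : |realDisc α p b| = 2
  interior : ∀ θ ∈ Set.Ioo a b, |realDisc α p θ| < 2

theorem IsBand.dichotomy {α : ℕ → ℂ} (hα : ∀ n, ‖α n‖ < 1) {p : ℕ} (hp : 0 < p) {a b : ℝ}
    (h : IsBand α p a b) :
    ((∀ θ ∈ Set.Ioo a b, 0 < (suPair α p θ).1.im) ∧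
      StrictAntiOn (realDisc α p) (Set.Icc a b) ∧ realDisc α p a = 2 ∧ realDisc α p b = -2) ∨
    ((∀ θ ∈ Set.Ioo a b, (suPair α p θ).1.im < 0) ∧
      StrictMonoOn (realDisc α p) (Set.Icc a b) ∧ realDisc α p a = -2 ∧ realDisc α p b = 2) := by
  have hl := eq_or_eq_neg_of_abs_eq h.left
  have hr := eq_or_eq_neg_of_abs_eq h.right
  have ha : a ∈ Set.Icc a b := ⟨le_rfl, h.lt.le⟩
  have hb : b ∈ Set.Icc a b := ⟨h.lt.le, le_rfl⟩
  refine (strictMonoOn_or_strictAntiOn hα hp h.interior).imp (fun hs => ⟨hs.1, hs.2, ?_⟩)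
    fun hs => ⟨hs.1, hs.2, ?_⟩
  · have := hs.2 ha hb h.lt
    rcases hl with hl | hl <;> rcases hr with hr | hr <;> first | exact ⟨hl, hr⟩ | linarith
  · have := hs.2 ha hb h.lt
    rcases hl with hl | hl <;> rcases hr with hr | hr <;> first | exact ⟨hl, hr⟩ | linarith

theorem IsBand.abs_le {α : ℕ → ℂ} {p : ℕ} {a b : ℝ} (h : IsBand α p a b) {θ : ℝ}
    (hθ : θ ∈ Set.Icc a b) : |realDisc α p θ| ≤ 2 := by
  rcases hθ.1.eq_or_lt with rfl | h1
  · exact h.left.le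
  rcases hθ.2.eq_or_lt with rfl | h2
  · exact h.right.le
  · exact (h.interior θ ⟨h1, h2⟩).le

/-- The point of the band `[a, b]` where `Δ = 2 cos t`. -/
noncomputable def levelPt (α : ℕ → ℂ) (p : ℕ) (a b t : ℝ) : ℝ :=
  Function.invFunOn (realDisc α p) (Set.Icc a b) (2 * Real.cos t)

theorem IsBand.levelPt_spec {α : ℕ → ℂ} (hα : ∀ n, ‖α n‖ < 1) {p : ℕ} (hp : 0 < p) {a b : ℝ}
    (h : IsBand α p a b) (t : ℝ) :
    levelPt α p a b t ∈ Set.Icc a b ∧ realDisc α p (levelPt α p a b t) = 2 * Real.cos t := by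
  have hc := (continuous_realDisc hα p).continuousOn (s := Set.Icc a b)
  have h1 := Real.neg_one_le_cos t
  have h2 := Real.cos_le_one t
  have hex : 2 * Real.cos t ∈ realDisc α p '' Set.Icc a b := by
    rcases h.dichotomy hα hp with ⟨-, -, hl, hr⟩ | ⟨-, -, hl, hr⟩
    · exact intermediate_value_Icc' h.lt.le hc ⟨by linarith, by linarith⟩
    · exact intermediate_value_Icc h.lt.le hc ⟨by linarith, by linarith⟩
  exact ⟨Function.invFunOn_mem hex, Function.invFunOn_eq hex⟩

theorem IsBand.levelPt_eq {α : ℕ → ℂ} (hα : ∀ n, ‖α n‖ < 1) {p : ℕ} (hp : 0 < p) {a b : ℝ}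
    (h : IsBand α p a b) {t θ : ℝ} (hθ : θ ∈ Set.Icc a b)
    (ht : realDisc α p θ = 2 * Real.cos t) : levelPt α p a b t = θ := by
  obtain ⟨h1, h2⟩ := h.levelPt_spec hα hp t
  exact realDisc_injOn hα hp h.interior h1 hθ (h2.trans ht.symm)

theorem abs_two_mul_cos_lt {t : ℝ} (ht : t ∈ Set.Ioo 0 Real.pi) : |2 * Real.cos t| < 2 := by
  have hpi := Real.pi_pos
  have h1 := Real.strictAntiOn_cos ⟨le_rfl, hpi.le⟩ ⟨ht.1.le, ht.2.le⟩ ht.1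
  have h2 := Real.strictAntiOn_cos ⟨ht.1.le, ht.2.le⟩ ⟨hpi.le, le_rfl⟩ ht.2
  rw [Real.cos_zero] at h1
  rw [Real.cos_pi] at h2
  rw [abs_lt]
  constructor <;> linarith

theorem IsBand.levelPt_mem_Ioo {α : ℕ → ℂ} (hα : ∀ n, ‖α n‖ < 1) {p : ℕ} (hp : 0 < p) {a b : ℝ}
    (h : IsBand α p a b) {t : ℝ} (ht : t ∈ Set.Ioo 0 Real.pi) :
    levelPt α p a b t ∈ Set.Ioo a b := by
  obtain ⟨h1, h2⟩ := h.levelPt_spec hα hp t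
  have h3 := abs_two_mul_cos_lt ht
  rw [← h2] at h3
  refine ⟨h1.1.lt_of_ne fun he => ?_, h1.2.lt_of_ne fun he => ?_⟩
  · rw [← he, h.left] at h3
    exact lt_irrefl _ h3
  · rw [he, h.right] at h3
    exact lt_irrefl _ h3

/-- The bands `[x_j, y_j]`, `1 ≤ j ≤ p`, in increasing order within one period. Unlike in
`IsBandEdges`, it is not required that they exhaust the set where `|Δ| ≤ 2`. -/
structure IsBandSystem (α : ℕ → ℂ) (p : ℕ) (x y : ℕ → ℝ) : Prop where
  wrap : x (p + 1) = x 1 + 2 * Real.pi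
  band : ∀ j ∈ Set.Icc 1 p, IsBand α p (x j) (y j)
  gap_le : ∀ j ∈ Set.Icc 1 p, y j ≤ x (j + 1)

namespace IsBandSystem

variable {α : ℕ → ℂ} {p : ℕ} {x y : ℕ → ℝ}

theorem y_le_x (h : IsBandSystem α p x y) {j k : ℕ} (hj : 1 ≤ j) (hjk : j < k) (hk : k ≤ p + 1) :
    y j ≤ x k := by
  induction k, hjk using Nat.le_induction with
  | base => exact h.gap_le j ⟨hj, by omega⟩
  | succ k hjk ih =>
    have hk' : k ∈ Set.Icc 1 p := ⟨by omega, by omega⟩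
    exact (ih (by omega)).trans ((h.band k hk').lt.le.trans (h.gap_le k hk'))

theorem x_le_x (h : IsBandSystem α p x y) {j k : ℕ} (hj : 1 ≤ j) (hjk : j ≤ k) (hk : k ≤ p + 1) :
    x j ≤ x k := by
  rcases hjk.eq_or_lt with rfl | hlt
  · exact le_rfl
  · exact (h.band j ⟨hj, by omega⟩).lt.le.trans (h.y_le_x hj hlt hk)

theorem y_le_y (h : IsBandSystem α p x y) {j k : ℕ} (hj : 1 ≤ j) (hjk : j ≤ k) (hk : k ≤ p) :
    y j ≤ y k := by
  rcases hjk.eq_or_lt with rfl | hlt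
  · exact le_rfl
  · exact (h.y_le_x hj hlt (by omega)).trans (h.band k ⟨by omega, hk⟩).lt.le

theorem x_one_le (h : IsBandSystem α p x y) {j : ℕ} (hj : j ∈ Set.Icc 1 p) : x 1 ≤ x j :=
  h.x_le_x le_rfl hj.1 (by have := hj.2; omega)

theorem y_le (h : IsBandSystem α p x y) {j : ℕ} (hj : j ∈ Set.Icc 1 p) :
    y j ≤ x 1 + 2 * Real.pi :=
  (h.y_le_x hj.1 (Nat.lt_succ_of_le hj.2) le_rfl).trans_eq h.wrap

/-- For `c = 2 cos t` strictly between `-2` and `2`, every band contains one solution of `Δ = c`;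
these are all the zeros of a polynomial of degree `p`. -/
theorem levelPoly_eval_eq_prod (h : IsBandSystem α p x y) (hα : ∀ n, ‖α n‖ < 1) (hp : 0 < p)
    (hpe : Even p) {t : ℝ} (ht : t ∈ Set.Ioo 0 Real.pi) (z : ℂ) :
    (levelPoly α p (2 * Real.cos t)).eval z =
      ∏ j ∈ Finset.Icc 1 p, (z - circlePt (levelPt α p (x j) (y j) t)) := by
  have hmem : ∀ j : Finset.Icc 1 p, (j : ℕ) ∈ Set.Icc 1 p := fun j => Finset.mem_Icc.1 j.2
  have hlt : ∀ j k : Finset.Icc 1 p, (j : ℕ) < k →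
      levelPt α p (x j) (y j) t < levelPt α p (x k) (y k) t := fun j k hjk =>
    ((h.band j (hmem j)).levelPt_mem_Ioo hα hp ht).2.trans
      ((h.y_le_x (hmem j).1 hjk (by have := (hmem k).2; omega)).trans_lt
        ((h.band k (hmem k)).levelPt_mem_Ioo hα hp ht).1)
  have hinj : Function.Injective
      fun j : Finset.Icc 1 p => circlePt (levelPt α p (x j) (y j) t) := by
    intro j k hjk
    have h1 := (h.band j (hmem j)).levelPt_mem_Ioo hα hp ht
    have h2 := (h.band k (hmem k)).levelPt_mem_Ioo hα hp ht
    have h3 := h.x_one_le (hmem j)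
    have h4 := h.x_one_le (hmem k)
    have h5 := h.y_le (hmem j)
    have h6 := h.y_le (hmem k)
    have h7 := eq_of_circlePt_eq hjk
      (by rw [abs_lt]; constructor <;> linarith [h1.1, h1.2, h2.1, h2.2])
    rcases lt_trichotomy (j : ℕ) k with hl | he | hl
    · exact absurd h7 (hlt j k hl).ne
    · exact Subtype.ext he
    · exact absurd h7 (hlt k j hl).ne'
  have hmon := levelPoly_monic α hp (2 * Real.cos t)
  have hroots := roots_eq_map_of_injective hmon.ne_zero
    (by simp [levelPoly_natDegree α hp]) hinj fun j => by
      rw [levelPoly_eval_circlePt_eq_zero_iff hα hpe]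
      exact ((h.band j (hmem j)).levelPt_spec hα hp t).2
  have hcard : (levelPoly α p (2 * Real.cos t)).roots.card
      = (levelPoly α p (2 * Real.cos t)).natDegree :=
    splits_iff_card_roots.1 (IsAlgClosed.splits _)
  have hprod := prod_multiset_X_sub_C_of_monic_of_roots_card_eq hmon hcard
  rw [← hprod, hroots, Multiset.map_map, eval_multiset_prod, Multiset.map_map]
  rw [← Finset.prod_coe_sort]
  simp [Finset.prod]

/-- The bands exhaust the set `|Δ| ≤ 2`: by continuity in `t` the product formula forces a zero
of `Δ - 2 cos t` to be approximated by points of the bands. -/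
theorem exists_mem_band (h : IsBandSystem α p x y) (hα : ∀ n, ‖α n‖ < 1) (hp : 0 < p)
    (hpe : Even p) {θ : ℝ} (hθ : |realDisc α p θ| ≤ 2) :
    ∃ j ∈ Set.Icc 1 p, ∃ φ ∈ Set.Icc (x j) (y j), circlePt φ = circlePt θ := by
  set K : Set ℂ := ⋃ j ∈ Finset.Icc 1 p, circlePt '' Set.Icc (x j) (y j) with hK
  have hclosed : IsClosed K :=
    (Finset.isCompact_biUnion _ fun j _ => isCompact_Icc.image continuous_circlePt).isClosed
  by_cases hmem : circlePt θ ∈ K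
  · simp only [hK, Set.mem_iUnion, Finset.mem_Icc] at hmem
    obtain ⟨j, hj, φ, hφ, he⟩ := hmem
    exact ⟨j, hj, φ, hφ, he⟩
  exfalso
  obtain ⟨ε, hε, hball⟩ := Metric.isOpen_iff.1 hclosed.isOpen_compl _ hmem
  rw [abs_le] at hθ
  set s := Real.arccos (realDisc α p θ / 2) with hs
  have hcos : realDisc α p θ = 2 * Real.cos s := by
    rw [hs, Real.cos_arccos (by linarith) (by linarith)]
    ring
  have hpi := Real.pi_pos
  have hsmem : s ∈ closure (Set.Ioo 0 Real.pi) := by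
    rw [closure_Ioo hpi.ne]
    exact ⟨Real.arccos_nonneg _, Real.arccos_le_pi _⟩
  have : (nhdsWithin s (Set.Ioo 0 Real.pi)).NeBot := mem_closure_iff_nhdsWithin_neBot.1 hsmem
  have hlim : Filter.Tendsto (fun t => rhoProd α p * |2 * Real.cos s - 2 * Real.cos t|)
      (nhdsWithin s (Set.Ioo 0 Real.pi)) (nhds 0) := by
    have hcont : Continuous fun t => rhoProd α p * |2 * Real.cos s - 2 * Real.cos t| := by fun_prop
    have := (hcont.tendsto s).mono_left (nhdsWithin_le_nhds (s := Set.Ioo 0 Real.pi))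
    simpa using this
  refine (pow_pos hε p).not_ge (ge_of_tendsto hlim ?_)
  filter_upwards [self_mem_nhdsWithin] with t ht
  have h1 := congrArg norm (h.levelPoly_eval_eq_prod hα hp hpe ht (circlePt θ))
  rw [levelPoly_eval_circlePt hα hpe, norm_mul, norm_pow, norm_circlePt, one_pow, one_mul,
    Complex.norm_real, Real.norm_eq_abs, abs_mul, abs_of_pos (rhoProd_pos hα p), hcos,
    norm_prod] at h1
  rw [h1]
  calc ε ^ p = ∏ j ∈ Finset.Icc 1 p, ε := by simp
    _ ≤ _ := Finset.prod_le_prod (fun _ _ => hε.le) fun j hj => by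
      by_contra! hlt
      have : circlePt (levelPt α p (x j) (y j) t) ∈ Metric.ball (circlePt θ) ε := by
        rwa [Metric.mem_ball, dist_comm, dist_eq_norm]
      apply hball this
      simp only [hK, Set.mem_iUnion]
      exact ⟨j, hj, _, ((h.band j (Finset.mem_Icc.1 hj)).levelPt_spec hα hp t).1, rfl⟩

/-- Inside the gaps `|Δ| > 2`. -/
theorem two_lt_abs_of_mem_gap (h : IsBandSystem α p x y) (hα : ∀ n, ‖α n‖ < 1) (hp : 0 < p)
    (hpe : Even p) {j : ℕ} (hj : j ∈ Set.Icc 1 p) {θ : ℝ} (hθ : θ ∈ Set.Ioo (y j) (x (j + 1))) :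
    2 < |realDisc α p θ| := by
  by_contra! hlt
  obtain ⟨k, hk, φ, hφ, he⟩ := h.exists_mem_band hα hp hpe hlt
  have h1 := h.x_one_le hk
  have h2 := h.y_le hk
  have h3 := h.x_one_le hj
  have h4 : x (j + 1) ≤ x 1 + 2 * Real.pi :=
    (h.x_le_x (by omega) (by have := hj.2; omega) le_rfl).trans_eq h.wrap
  have h5 := (h.band j hj).lt
  have h6 := eq_of_circlePt_eq he
    (by rw [abs_lt]; constructor <;> linarith [hθ.1, hθ.2, hφ.1, hφ.2])
  rcases le_or_gt k j with hkj | hkj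
  · linarith [h.y_le_y hk.1 hkj hj.2, hφ.2, hθ.1]
  · linarith [h.x_le_x (j := j + 1) (by omega) hkj (by have := hk.2; omega), hφ.1, hθ.2]

end IsBandSystem

/-- Across a gap, `Im u` changes its sign between the two neighbouring bands, because `Δ` takes the
same value at both ends of the gap; so does the function whose zeros are the Dirichlet points. -/
theorem exists_dirichletFun_eq_zero {α : ℕ → ℂ} (hα : ∀ n, ‖α n‖ < 1) {p : ℕ} (hp : 0 < p)
    {a b c d : ℝ} (h1 : IsBand α p a b) (h2 : IsBand α p c d) (hbc : b ≤ c)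
    (hgap : ∀ θ ∈ Set.Ioo b c, 2 < |realDisc α p θ|) :
    ∃ θ ∈ Set.Icc b c, dirichletFun α p θ = 0 := by
  have hD := continuous_realDisc hα p
  have hf := continuous_dirichletFun hα p
  have hzero : ∀ v : ℝ, |v| < 2 → v ∉ realDisc α p '' Set.Icc b c := by
    rintro v hv ⟨θ, hθ, rfl⟩
    rcases hθ.1.eq_or_lt with rfl | hb
    · exact hv.ne h1.right
    rcases hθ.2.eq_or_lt with rfl | hc
    · exact hv.ne h2.left
    · exact hv.not_gt (hgap θ ⟨hb, hc⟩)
  have hright : Filter.Tendsto (dirichletFun α p) (nhdsWithin b (Set.Iio b))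
      (nhds (dirichletFun α p b)) := (hf.tendsto b).mono_left nhdsWithin_le_nhds
  have hleft : Filter.Tendsto (dirichletFun α p) (nhdsWithin c (Set.Ioi c))
      (nhds (dirichletFun α p c)) := (hf.tendsto c).mono_left nhdsWithin_le_nhds
  have hevb := Ioo_mem_nhdsLT h1.lt
  have hevc := Ioo_mem_nhdsGT h2.lt
  rcases h1.dichotomy hα hp with ⟨hs1, -, -, hb⟩ | ⟨hs1, -, -, hb⟩ <;>
    rcases h2.dichotomy hα hp with ⟨hs2, -, hc, -⟩ | ⟨hs2, -, hc, -⟩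
  · exact absurd (intermediate_value_Icc hbc hD.continuousOn ⟨by rw [hb]; norm_num, by
      rw [hc]; norm_num⟩) (hzero 0 (by norm_num))
  · have hb' : 0 ≤ dirichletFun α p b := ge_of_tendsto hright (by
      filter_upwards [hevb] with θ hθ
      have := dirichletFun_mul_im_pos hα (h1.interior θ hθ)
      exact (pos_of_mul_pos_left this (hs1 θ hθ).le).le)
    have hc' : dirichletFun α p c ≤ 0 := le_of_tendsto hleft (by
      filter_upwards [hevc] with θ hθ
      have := dirichletFun_mul_im_pos hα (h2.interior θ hθ)
      by_contra! hcon
      nlinarith [hs2 θ hθ])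
    exact intermediate_value_Icc' hbc hf.continuousOn ⟨hc', hb'⟩
  · have hb' : dirichletFun α p b ≤ 0 := le_of_tendsto hright (by
      filter_upwards [hevb] with θ hθ
      have := dirichletFun_mul_im_pos hα (h1.interior θ hθ)
      by_contra! hcon
      nlinarith [hs1 θ hθ])
    have hc' : 0 ≤ dirichletFun α p c := ge_of_tendsto hleft (by
      filter_upwards [hevc] with θ hθ
      have := dirichletFun_mul_im_pos hα (h2.interior θ hθ)
      exact (pos_of_mul_pos_left this (hs2 θ hθ).le).le)
    exact intermediate_value_Icc hbc hf.continuousOn ⟨hb', hc'⟩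
  · exact absurd (intermediate_value_Icc' hbc hD.continuousOn ⟨by rw [hc]; norm_num, by
      rw [hb]; norm_num⟩) (hzero 0 (by norm_num))

theorem IsBandSystem.exists_dirichletFun_eq_zero {α : ℕ → ℂ} {p : ℕ} {x y : ℕ → ℝ}
    (h : IsBandSystem α p x y) (hα : ∀ n, ‖α n‖ < 1) (hp : 0 < p) (hpe : Even p) {j : ℕ}
    (hj : j ∈ Set.Icc 1 p) : ∃ θ ∈ Set.Icc (y j) (x (j + 1)), dirichletFun α p θ = 0 := by
  have hgap := fun θ (hθ : θ ∈ Set.Ioo (y j) (x (j + 1))) => h.two_lt_abs_of_mem_gap hα hp hpe hj hθ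
  rcases hj.2.eq_or_lt with rfl | hlt
  · have h1 := h.band 1 ⟨le_rfl, hp⟩
    have h2 : IsBand α j (x (j + 1)) (y 1 + 2 * Real.pi) := by
      rw [h.wrap]
      refine ⟨by linarith [h1.lt], ?_, ?_, fun θ hθ => ?_⟩
      · rw [realDisc_add_two_pi α hpe, h1.left]
      · rw [realDisc_add_two_pi α hpe, h1.right]
      · rw [← sub_add_cancel θ (2 * Real.pi), realDisc_add_two_pi α hpe]
        exact h1.interior _ ⟨by linarith [hθ.1], by linarith [hθ.2]⟩
    exact PeriodicOPUC.exists_dirichletFun_eq_zero hα hp (h.band j hj) h2 (h.gap_le j hj) hgap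
  · exact PeriodicOPUC.exists_dirichletFun_eq_zero hα hp (h.band j hj)
      (h.band (j + 1) ⟨by omega, hlt⟩) (h.gap_le j hj) hgap

/-! ### Existence of the band edges -/

theorem exists_two_le_abs {α : ℕ → ℂ} (hα : ∀ n, ‖α n‖ < 1) {p : ℕ} (hp : 0 < p) {s t : ℝ}
    (hst : s < t) (h : realDisc α p s = realDisc α p t) :
    ∃ r ∈ Set.Ioo s t, 2 ≤ |realDisc α p r| := by
  by_contra! hcon
  exact hst.ne (realDisc_injOn hα hp hcon ⟨le_rfl, hst.le⟩ ⟨hst.le, le_rfl⟩ h)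

theorem exists_right_edge {α : ℕ → ℂ} (hα : ∀ n, ‖α n‖ < 1) {p : ℕ} (hp : 0 < p)
    (hpe : Even p) {t : ℝ} (ht : |realDisc α p t| < 2) :
    ∃ b, t < b ∧ |realDisc α p b| = 2 ∧ ∀ θ ∈ Set.Ico t b, |realDisc α p θ| < 2 := by
  have hc := (continuous_realDisc hα p).abs
  have hpi := Real.pi_pos
  set S := Set.Icc t (t + 2 * Real.pi) ∩ {θ | 2 ≤ |realDisc α p θ|} with hS
  have hcomp : IsCompact S := isCompact_Icc.inter_right (isClosed_le continuous_const hc)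
  obtain ⟨r, hr, hr2⟩ := exists_two_le_abs hα hp (s := t) (t := t + 2 * Real.pi) (by linarith)
    (realDisc_add_two_pi α hpe t).symm
  obtain ⟨b, hb, hmin⟩ := hcomp.exists_isLeast ⟨r, ⟨hr.1.le, hr.2.le⟩, hr2⟩
  have hb2 : 2 ≤ |realDisc α p b| := hb.2
  obtain ⟨θ, hθ, hθ2⟩ := intermediate_value_Icc hb.1.1 hc.continuousOn ⟨ht.le, hb2⟩
  have hθb : θ = b := le_antisymm hθ.2 (hmin ⟨⟨hθ.1, hθ.2.trans hb.1.2⟩, hθ2.ge⟩)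
  rw [hθb] at hθ2
  refine ⟨b, hb.1.1.lt_of_ne fun he => ?_, hθ2, fun φ hφ => ?_⟩
  · rw [← he] at hθ2
    exact ht.ne hθ2
  · by_contra! hcon
    exact (hmin ⟨⟨hφ.1, hφ.2.le.trans hb.1.2⟩, hcon⟩).not_gt hφ.2

theorem exists_left_edge {α : ℕ → ℂ} (hα : ∀ n, ‖α n‖ < 1) {p : ℕ} (hp : 0 < p)
    (hpe : Even p) {t : ℝ} (ht : |realDisc α p t| < 2) :
    ∃ a, a < t ∧ |realDisc α p a| = 2 ∧ ∀ θ ∈ Set.Ioc a t, |realDisc α p θ| < 2 := by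
  have hc := (continuous_realDisc hα p).abs
  have hpi := Real.pi_pos
  set S := Set.Icc (t - 2 * Real.pi) t ∩ {θ | 2 ≤ |realDisc α p θ|} with hS
  have hcomp : IsCompact S := isCompact_Icc.inter_right (isClosed_le continuous_const hc)
  obtain ⟨r, hr, hr2⟩ := exists_two_le_abs hα hp (s := t - 2 * Real.pi) (t := t) (by linarith)
    (by rw [← realDisc_add_two_pi α hpe (t - 2 * Real.pi), sub_add_cancel])
  obtain ⟨a, ha, hmax⟩ := hcomp.exists_isGreatest ⟨r, ⟨hr.1.le, hr.2.le⟩, hr2⟩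
  have ha2 : 2 ≤ |realDisc α p a| := ha.2
  obtain ⟨θ, hθ, hθ2⟩ := intermediate_value_Icc' ha.1.2 hc.continuousOn ⟨ht.le, ha2⟩
  have hθa : θ = a := le_antisymm (hmax ⟨⟨ha.1.1.trans hθ.1, hθ.2⟩, hθ2.ge⟩) hθ.1
  rw [hθa] at hθ2
  refine ⟨a, ha.1.2.lt_of_ne fun he => ?_, hθ2, fun φ hφ => ?_⟩
  · rw [he] at hθ2
    exact ht.ne hθ2
  · by_contra! hcon
    exact (hmax ⟨⟨ha.1.1.trans hφ.1.le, hφ.2⟩, hcon⟩).not_gt hφ.1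

theorem realDisc_add_int_mul (α : ℕ → ℂ) {p : ℕ} (hpe : Even p) (θ : ℝ) (n : ℤ) :
    realDisc α p (θ + n * (2 * Real.pi)) = realDisc α p θ :=
  Function.Periodic.int_mul (realDisc_add_two_pi α hpe) n θ

theorem exists_finset_zeros {α : ℕ → ℂ} (hα : ∀ n, ‖α n‖ < 1) {p : ℕ} (hp : 0 < p)
    (hpe : Even p) (a : ℝ) : ∃ Z : Finset ℝ, Z.card = p ∧
      ∀ t, t ∈ Z ↔ t ∈ Set.Ico a (a + 2 * Real.pi) ∧ realDisc α p t = 0 := by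
  classical
  obtain ⟨hnodup, hcard, hcirc⟩ := levelPoly_zero_roots hα hp hpe
  have hne := (levelPoly_monic α hp 0).ne_zero
  choose! g hg hg' using fun z (hz : ‖z‖ = 1) => exists_circlePt_eq hz a
  refine ⟨(levelPoly α p 0).roots.toFinset.image g, ?_, fun t => ?_⟩
  · rw [Finset.card_image_of_injOn, Multiset.toFinset_card_of_nodup hnodup, hcard]
    intro z hz w hw hzw
    simp only [Finset.mem_coe, Multiset.mem_toFinset] at hz hw
    rw [← hg' z (hcirc z hz), ← hg' w (hcirc w hw), hzw]
  · simp only [Finset.mem_image, Multiset.mem_toFinset]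
    constructor
    · rintro ⟨z, hz, rfl⟩
      refine ⟨hg z (hcirc z hz), ?_⟩
      rw [← levelPoly_eval_circlePt_eq_zero_iff hα hpe, hg' z (hcirc z hz)]
      exact (mem_roots hne).1 hz
    · rintro ⟨ht, hD⟩
      refine ⟨circlePt t, (mem_roots hne).2
        ((levelPoly_eval_circlePt_eq_zero_iff hα hpe 0 t).2 hD), ?_⟩
      have h1 := hg _ (norm_circlePt t)
      refine eq_of_circlePt_eq (hg' _ (norm_circlePt t)) ?_
      rw [abs_lt]
      constructor <;> linarith [h1.1, h1.2, ht.1, ht.2]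

/-- The `p` zeros of `Δ` in one period lie in `p` different bands, since `Δ` is injective on each
of them. The period starts at the left edge of a band, so that no band is cut in two. -/
theorem exists_isBandSystem {α : ℕ → ℂ} (hα : ∀ n, ‖α n‖ < 1) {p : ℕ} (hp : 0 < p)
    (hpe : Even p) : ∃ x y : ℕ → ℝ, x 1 ∈ Set.Ico 0 (2 * Real.pi) ∧ IsBandSystem α p x y := by
  have hpi := Real.pi_pos
  have hlt2 : ∀ t, realDisc α p t = 0 → |realDisc α p t| < 2 := fun t ht => by
    rw [ht]
    norm_num
  choose! l hl1 hl2 hl3 using fun t (ht : realDisc α p t = 0) => exists_left_edge hα hp hpe (hlt2 t ht)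
  choose! r hr1 hr2 hr3 using fun t (ht : realDisc α p t = 0) => exists_right_edge hα hp hpe (hlt2 t ht)
  have hluniq : ∀ t, realDisc α p t = 0 → ∀ a, a < t → |realDisc α p a| = 2 →
      (∀ θ ∈ Set.Ioc a t, |realDisc α p θ| < 2) → l t = a := by
    intro t ht a ha ha2 ha3
    refine le_antisymm ?_ ?_
    · by_contra! hcon
      exact (ha3 (l t) ⟨hcon, (hl1 t ht).le⟩).ne (hl2 t ht)
    · by_contra! hcon
      exact (hl3 t ht a ⟨hcon, ha.le⟩).ne ha2
  obtain ⟨t₀, ht₀, hx0⟩ : ∃ t, realDisc α p t = 0 ∧ l t ∈ Set.Ico 0 (2 * Real.pi) := by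
    obtain ⟨Z, hZ, hZmem⟩ := exists_finset_zeros hα hp hpe 0
    obtain ⟨s, hs⟩ : Z.Nonempty := by
      rw [← Finset.card_pos]
      omega
    have hs0 := ((hZmem s).1 hs).2
    set n : ℤ := -toIcoDiv Real.two_pi_pos 0 (l s) with hn
    have hmod : l s + n * (2 * Real.pi) ∈ Set.Ico 0 (2 * Real.pi) := by
      have h1 := toIcoMod_mem_Ico Real.two_pi_pos 0 (l s)
      have h2 := toIcoMod_add_toIcoDiv_zsmul Real.two_pi_pos 0 (l s)
      rw [zsmul_eq_mul] at h2
      rw [zero_add] at h1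
      have h3 : l s + n * (2 * Real.pi) = toIcoMod Real.two_pi_pos 0 (l s) := by
        rw [hn]
        push_cast
        linarith
      rwa [h3]
    have hs1 : realDisc α p (s + n * (2 * Real.pi)) = 0 := by rw [realDisc_add_int_mul α hpe, hs0]
    refine ⟨s + n * (2 * Real.pi), hs1, ?_⟩
    rw [hluniq _ hs1 (l s + n * (2 * Real.pi)) (by linarith [hl1 s hs0])
      (by rw [realDisc_add_int_mul α hpe, hl2 s hs0]) fun θ hθ => ?_]
    · exact hmod
    · have := realDisc_add_int_mul α hpe (θ - n * (2 * Real.pi)) n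
      rw [sub_add_cancel] at this
      rw [this]
      exact hl3 s hs0 _ ⟨by linarith [hθ.1], by linarith [hθ.2]⟩
  set a := l t₀ with ha
  have ha2 : |realDisc α p a| = 2 := hl2 t₀ ht₀
  have ha2' : |realDisc α p (a + 2 * Real.pi)| = 2 := by rw [realDisc_add_two_pi α hpe, ha2]
  have hat : a < t₀ := hl1 t₀ ht₀
  obtain ⟨Z, hZ, hZmem⟩ := exists_finset_zeros hα hp hpe a
  have ht₀Z : t₀ ∈ Z := by
    refine (hZmem t₀).2 ⟨⟨hat.le, ?_⟩, ht₀⟩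
    by_contra! hcon
    exact (hl3 t₀ ht₀ _ ⟨by linarith, hcon⟩).ne ha2'
  set e := Z.orderEmbOfFin hZ with he
  have heZ : ∀ i, e i ∈ Z := fun i => Z.orderEmbOfFin_mem hZ i
  have he0 : e ⟨0, hp⟩ = t₀ := by
    have h1 : e ⟨0, hp⟩ = Z.min' ⟨t₀, ht₀Z⟩ := Finset.orderEmbOfFin_zero hZ hp
    have h2 : e ⟨0, hp⟩ ≤ t₀ := by
      rw [h1]
      exact Z.min'_le _ ht₀Z
    obtain ⟨h3, h4⟩ := (hZmem _).1 (heZ ⟨0, hp⟩)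
    by_contra hne
    obtain ⟨s, hs, hs2⟩ := exists_two_le_abs hα hp (h2.lt_of_ne hne) (h4.trans ht₀.symm)
    exact (hl3 t₀ ht₀ s ⟨h3.1.trans_lt hs.1, hs.2.le⟩).not_ge hs2
  set τ : ℕ → ℝ := fun j => if hj : j - 1 < p then e ⟨j - 1, hj⟩ else 0 with hτ
  have hτe : ∀ j (hj : j ∈ Set.Icc 1 p), τ j = e ⟨j - 1, by have := hj.1; have := hj.2; omega⟩ :=
    fun j hj => dif_pos _
  have hτZ : ∀ j ∈ Set.Icc 1 p, τ j ∈ Z := fun j hj => by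
    rw [hτe j hj]
    exact heZ _
  have hτ0 : ∀ j ∈ Set.Icc 1 p, realDisc α p (τ j) = 0 := fun j hj =>
    ((hZmem _).1 (hτZ j hj)).2
  have hτlt : ∀ j ∈ Set.Icc 1 p, j + 1 ∈ Set.Icc 1 p → τ j < τ (j + 1) := fun j hj hj' => by
    rw [hτe j hj, hτe _ hj']
    refine e.strictMono ?_
    have := hj.1
    rw [Fin.mk_lt_mk]
    omega
  have hτ1 : τ 1 = t₀ := by
    rw [hτe 1 ⟨le_rfl, hp⟩]
    exact he0
  have hx1 : (if 1 = p + 1 then a + 2 * Real.pi else l (τ 1)) = a := by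
    rw [if_neg (by omega), hτ1]
  refine ⟨fun j => if j = p + 1 then a + 2 * Real.pi else l (τ j), fun j => r (τ j), ?_, ?_, ?_, ?_⟩
  · simp only [hx1]
    exact hx0
  · simp only [hx1, if_pos]
  · intro j hj
    have h0 := hτ0 j hj
    have hne : j ≠ p + 1 := by
      have := hj.2
      omega
    simp only [if_neg hne]
    refine ⟨(hl1 _ h0).trans (hr1 _ h0), hl2 _ h0, hr2 _ h0, fun θ hθ => ?_⟩
    rcases le_total θ (τ j) with h | h
    · exact hl3 _ h0 _ ⟨hθ.1, h⟩
    · exact hr3 _ h0 _ ⟨h, hθ.2⟩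
  · intro j hj
    have h0 := hτ0 j hj
    rcases hj.2.eq_or_lt with hjp | hjp
    · simp only [hjp, if_pos]
      rw [hjp] at h0
      by_contra! hcon
      have h1 := ((hZmem _).1 (hτZ p ⟨hp, le_rfl⟩)).1.2
      exact (hr3 _ h0 _ ⟨h1.le, hcon⟩).ne ha2'
    · have hj' : j + 1 ∈ Set.Icc 1 p := ⟨by omega, hjp⟩
      have h0' := hτ0 _ hj'
      have hne : j + 1 ≠ p + 1 := by omega
      simp only [if_neg hne]
      obtain ⟨s, hs, hs2⟩ := exists_two_le_abs hα hp (hτlt j hj hj') (h0.trans h0'.symm)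
      have h1 : r (τ j) ≤ s := by
        by_contra! hcon
        exact (hr3 _ h0 s ⟨hs.1.le, hcon⟩).not_ge hs2
      have h2 : s ≤ l (τ (j + 1)) := by
        by_contra! hcon
        exact (hl3 _ h0' s ⟨hcon, hs.2.le⟩).not_ge hs2
      exact h1.trans h2

theorem circlePt_mem_bandSet_iff (α : ℕ → ℂ) {p : ℕ} (hpe : Even p) (θ : ℝ) :
    circlePt θ ∈ bandSet α p ↔ |realDisc α p θ| ≤ 2 := by
  rw [bandSet, Set.mem_ofPred_eq, discriminant_circlePt α hpe, abs_le]
  constructor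
  · rintro ⟨-, t, ht, he⟩
    rw [Complex.ofReal_injective he]
    exact ht
  · exact fun h => ⟨norm_circlePt θ, _, h, rfl⟩

theorem discriminant_circlePt_eq_two_or_iff (α : ℕ → ℂ) {p : ℕ} (hpe : Even p) (θ : ℝ) :
    (discriminant α p (circlePt θ) = 2 ∨ discriminant α p (circlePt θ) = -2) ↔
      |realDisc α p θ| = 2 := by
  rw [discriminant_circlePt α hpe, abs_eq (by norm_num)]
  norm_cast

theorem IsBandSystem.isBandEdges {α : ℕ → ℂ} {p : ℕ} {x y : ℕ → ℝ} (h : IsBandSystem α p x y)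
    (hα : ∀ n, ‖α n‖ < 1) (hp : 0 < p) (hpe : Even p) (h1 : x 1 ∈ Set.Ico 0 (2 * Real.pi)) :
    IsBandEdges α p x y where
  start := h1
  wrap := h.wrap
  band_lt j hj := (h.band j hj).lt
  gap_le := h.gap_le
  edge_left j hj := (discriminant_circlePt_eq_two_or_iff α hpe _).2 (h.band j hj).left
  edge_right j hj := (discriminant_circlePt_eq_two_or_iff α hpe _).2 (h.band j hj).right
  interior j hj θ hθ := by
    rw [← not_or, discriminant_circlePt_eq_two_or_iff α hpe]
    exact ((h.band j hj).interior θ hθ).ne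
  union := by
    ext z
    simp only [Set.mem_iUnion, Set.mem_image]
    constructor
    · rintro ⟨j, hj, θ, hθ, rfl⟩
      exact (circlePt_mem_bandSet_iff α hpe θ).2 ((h.band j hj).abs_le hθ)
    · intro hz
      obtain ⟨θ, -, rfl⟩ := exists_circlePt_eq hz.1 0
      obtain ⟨j, hj, φ, hφ, he⟩ :=
        h.exists_mem_band hα hp hpe ((circlePt_mem_bandSet_iff α hpe θ).1 hz)
      exact ⟨j, hj, φ, hφ, he⟩

theorem IsBandEdges.isBandSystem {α : ℕ → ℂ} {p : ℕ} {x y : ℕ → ℝ} (h : IsBandEdges α p x y)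
    (hpe : Even p) : IsBandSystem α p x y where
  wrap := h.wrap
  band j hj :=
    { lt := h.band_lt j hj
      left := (discriminant_circlePt_eq_two_or_iff α hpe _).1 (h.edge_left j hj)
      right := (discriminant_circlePt_eq_two_or_iff α hpe _).1 (h.edge_right j hj)
      interior := fun θ hθ => by
        refine lt_of_le_of_ne ?_ fun he => ?_
        · rw [← circlePt_mem_bandSet_iff α hpe, ← h.union]
          exact Set.mem_biUnion hj ⟨θ, Set.Ioo_subset_Icc_self hθ, rfl⟩
        · have := h.interior j hj θ hθ
          rw [← discriminant_circlePt_eq_two_or_iff α hpe] at he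
          tauto }
  gap_le := h.gap_le

section Potential

open MeasureTheory Filter Topology

/-! ### Logarithmic energy on the unit circle -/

/-- The logarithmic kernel; its value on the diagonal is a junk value. -/
noncomputable def logKernel (q : ℂ × ℂ) : ℝ := -Real.log ‖q.1 - q.2‖

theorem measurable_logKernel : Measurable logKernel := by
  unfold logKernel
  fun_prop

theorem ennreal_log_edist {z w : ℂ} (h : z ≠ w) :
    ENNReal.log (edist z w) = ((-logKernel (z, w) : ℝ) : EReal) := by
  have h0 : 0 < ‖z - w‖ := norm_pos_iff.2 (sub_ne_zero.2 h)
  rw [edist_dist, dist_eq_norm, ENNReal.log_ofReal_of_pos h0, logKernel, neg_neg]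

theorem neg_log_edist_toENNReal {z w : ℂ} (h : z ≠ w) :
    (-(ENNReal.log (edist z w))).toENNReal = ENNReal.ofReal (logKernel (z, w)) := by
  rw [ennreal_log_edist h, ← EReal.coe_neg, neg_neg, EReal.real_coe_toENNReal]

theorem log_edist_toENNReal {z w : ℂ} (h : z ≠ w) :
    (ENNReal.log (edist z w)).toENNReal = ENNReal.ofReal (-logKernel (z, w)) := by
  rw [ennreal_log_edist h, EReal.real_coe_toENNReal]

theorem neg_log_two_le_logKernel {z w : ℂ} (hz : ‖z‖ = 1) (hw : ‖w‖ = 1) :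
    -Real.log 2 ≤ logKernel (z, w) := by
  rw [logKernel, neg_le_neg_iff]
  rcases (norm_nonneg (z - w)).eq_or_lt with h0 | h0
  · simp only [← h0, Real.log_zero]
    exact Real.log_nonneg (by norm_num)
  · refine Real.log_le_log h0 ((norm_sub_le z w).trans ?_)
    rw [hz, hw]
    norm_num

variable {μ ν : Measure ℂ}

theorem ae_norm_eq_one {K : Set ℂ} (hK : ∀ z ∈ K, ‖z‖ = 1) (hμ : μ Kᶜ = 0) :
    ∀ᵐ z ∂μ, ‖z‖ = 1 :=
  Filter.mem_of_superset (mem_ae_iff.2 hμ) hK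

theorem ae_prod_norm_eq_one [SFinite ν] (hμ : ∀ᵐ z ∂μ, ‖z‖ = 1)
    (hν : ∀ᵐ z ∂ν, ‖z‖ = 1) : ∀ᵐ q ∂μ.prod ν, ‖q.1‖ = 1 ∧ ‖q.2‖ = 1 :=
  (Measure.quasiMeasurePreserving_fst.ae hμ).and (Measure.quasiMeasurePreserving_snd.ae hν)

theorem measurable_log_edist : Measurable fun q : ℂ × ℂ => ENNReal.log (edist q.1 q.2) :=
  ENNReal.measurable_log.comp measurable_edist

theorem ae_ne_of_logEnergy_lt_top [IsProbabilityMeasure μ] (hμ : ∀ᵐ z ∂μ, ‖z‖ = 1)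
    (h : logEnergy μ < ⊤) : (∀ᵐ q ∂μ.prod μ, q.1 ≠ q.2) ∧ Integrable logKernel (μ.prod μ) := by
  have hcirc := ae_prod_norm_eq_one hμ hμ
  have hm := measurable_log_edist
  have hmP : Measurable fun q : ℂ × ℂ => (-(ENNReal.log (edist q.1 q.2))).toENNReal :=
    hm.neg.ereal_toENNReal
  have hmN : Measurable fun q : ℂ × ℂ => (ENNReal.log (edist q.1 q.2)).toENNReal :=
    hm.ereal_toENNReal
  have hN : ∫⁻ q, (ENNReal.log (edist q.1 q.2)).toENNReal ∂μ.prod μ ≤ ENNReal.ofReal (Real.log 2) := by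
    calc _ ≤ ∫⁻ q, ENNReal.ofReal (Real.log 2) ∂μ.prod μ := by
          refine lintegral_mono_ae ?_
          filter_upwards [hcirc] with q hq
          by_cases hne : q.1 = q.2
          · simp [hne]
          · rw [log_edist_toENNReal hne]
            exact ENNReal.ofReal_le_ofReal (by linarith [neg_log_two_le_logKernel hq.1 hq.2])
      _ = _ := by simp
  have hP : ∫⁻ q, (-(ENNReal.log (edist q.1 q.2))).toENNReal ∂μ.prod μ ≠ ⊤ := by
    intro hP
    rw [logEnergy, ← lintegral_prod _ hmP.aemeasurable, ← lintegral_prod _ hmN.aemeasurable, hP] at h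
    lift ∫⁻ q, (ENNReal.log (edist q.1 q.2)).toENNReal ∂μ.prod μ to NNReal
      using (hN.trans_lt ENNReal.ofReal_lt_top).ne with c
    exact h.ne (EReal.top_sub_coe c)
  have hne : ∀ᵐ q ∂μ.prod μ, q.1 ≠ q.2 := by
    filter_upwards [ae_lt_top hmP hP] with q hq he
    simp [he] at hq
  refine ⟨hne, measurable_logKernel.aestronglyMeasurable, ?_⟩
  have hle : ∫⁻ q, ‖logKernel q‖ₑ ∂μ.prod μ ≤
      ∫⁻ q, ((-(ENNReal.log (edist q.1 q.2))).toENNReal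
        + (ENNReal.log (edist q.1 q.2)).toENNReal) ∂μ.prod μ := by
    refine lintegral_mono_ae ?_
    filter_upwards [hne] with q hq
    rw [neg_log_edist_toENNReal hq, log_edist_toENNReal hq, Real.enorm_eq_ofReal_abs]
    rcases abs_cases (logKernel q) with ⟨h1, -⟩ | ⟨h1, -⟩ <;> rw [h1]
    · exact le_self_add
    · exact le_add_self
  refine hle.trans_lt ?_
  rw [lintegral_add_left hmP]
  exact ENNReal.add_lt_top.2 ⟨hP.lt_top, hN.trans_lt ENNReal.ofReal_lt_top⟩

theorem logEnergy_eq_integral [IsProbabilityMeasure μ] (hne : ∀ᵐ q ∂μ.prod μ, q.1 ≠ q.2)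
    (hint : Integrable logKernel (μ.prod μ)) :
    logEnergy μ = ((∫ q, logKernel q ∂μ.prod μ : ℝ) : EReal) := by
  have hm := measurable_log_edist
  rw [logEnergy, ← lintegral_prod (fun q : ℂ × ℂ => (-(ENNReal.log (edist q.1 q.2))).toENNReal)
      hm.neg.ereal_toENNReal.aemeasurable,
    ← lintegral_prod (fun q : ℂ × ℂ => (ENNReal.log (edist q.1 q.2)).toENNReal)
      hm.ereal_toENNReal.aemeasurable]
  have h1 : ∫⁻ q, (-(ENNReal.log (edist q.1 q.2))).toENNReal ∂μ.prod μ =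
      ∫⁻ q, ENNReal.ofReal (logKernel q) ∂μ.prod μ := by
    refine lintegral_congr_ae ?_
    filter_upwards [hne] with q hq
    exact neg_log_edist_toENNReal hq
  have h2 : ∫⁻ q, (ENNReal.log (edist q.1 q.2)).toENNReal ∂μ.prod μ =
      ∫⁻ q, ENNReal.ofReal (-logKernel q) ∂μ.prod μ := by
    refine lintegral_congr_ae ?_
    filter_upwards [hne] with q hq
    exact log_edist_toENNReal hq
  have h3 := hint.lintegral_lt_top
  have h4 := hint.neg.lintegral_lt_top
  simp only [Pi.neg_apply] at h4
  rw [h1, h2, integral_eq_lintegral_pos_part_sub_lintegral_neg_part hint, EReal.coe_sub,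
    ← EReal.coe_ennreal_toReal h3.ne, ← EReal.coe_ennreal_toReal h4.ne]

/-! ### Abel regularisation of the energy -/

/-- The moments `∫ z^n dμ`. -/
noncomputable def moment (μ : Measure ℂ) (n : ℕ) : ℂ := ∫ z, z ^ n ∂μ

/-- The regularised kernel `-log |1 - r z conj w|`. -/
noncomputable def abelKernel (r : ℝ) (q : ℂ × ℂ) : ℝ := -Real.log ‖1 - r * (q.1 * conj q.2)‖

theorem measurable_abelKernel (r : ℝ) : Measurable (abelKernel r) := by
  unfold abelKernel
  fun_prop

/-- The logarithmic kernel of the circle has the positive Fourier coefficients `1 / (2 |n|)`,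
`n ≠ 0`. The term with `n = 0` vanishes, as division by zero gives `0`. -/
theorem hasSum_integral_abelKernel [IsProbabilityMeasure μ] [IsProbabilityMeasure ν]
    (hμ : ∀ᵐ z ∂μ, ‖z‖ = 1) (hν : ∀ᵐ z ∂ν, ‖z‖ = 1) {r : ℝ} (h0 : 0 ≤ r) (h1 : r < 1) :
    HasSum (fun n : ℕ => r ^ n / n * (moment μ n * conj (moment ν n)).re)
      (∫ q, abelKernel r q ∂μ.prod ν) := by
  have hcirc := ae_prod_norm_eq_one hμ hν
  set F : ℕ → ℂ × ℂ → ℝ := fun n q => r ^ n / n * (q.1 ^ n * conj (q.2 ^ n)).re with hF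
  have hFm : ∀ n, Measurable (F n) := fun n => by
    simp only [hF]
    fun_prop
  have hbound : ∀ n, ∀ᵐ q ∂μ.prod ν, ‖F n q‖ ≤ r ^ n := fun n => by
    filter_upwards [hcirc] with q hq
    have h2 : |(q.1 ^ n * conj (q.2 ^ n)).re| ≤ 1 := by
      refine (Complex.abs_re_le_norm _).trans ?_
      simp [hq.1, hq.2]
    have h3 : r ^ n / n ≤ r ^ n := by
      rcases n.eq_zero_or_pos with rfl | hn
      · simp
      · exact div_le_self (pow_nonneg h0 n) (by exact_mod_cast hn)
    rw [hF, Real.norm_eq_abs, abs_mul, abs_of_nonneg (by positivity)]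
    calc r ^ n / n * |(q.1 ^ n * conj (q.2 ^ n)).re| ≤ r ^ n / n * 1 := by gcongr
      _ ≤ r ^ n := by rwa [mul_one]
  have hFint : ∀ n, Integrable (F n) (μ.prod ν) := fun n =>
    Integrable.of_bound (hFm n).aestronglyMeasurable _ (hbound n)
  have hsum : Summable fun n => ∫ q, ‖F n q‖ ∂μ.prod ν := by
    refine Summable.of_nonneg_of_le (fun n => integral_nonneg fun q => norm_nonneg _) (fun n => ?_)
      (summable_geometric_of_lt_one h0 h1)
    calc ∫ q, ‖F n q‖ ∂μ.prod ν ≤ ∫ q, r ^ n ∂μ.prod ν :=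
          integral_mono_ae (hFint n).norm (integrable_const _) (hbound n)
      _ = r ^ n := by simp
  have hmain := hasSum_integral_of_summable_integral_norm hFint hsum
  have hterm : ∀ n, ∫ q, F n q ∂μ.prod ν = r ^ n / n * (moment μ n * conj (moment ν n)).re := by
    intro n
    have hint : Integrable (fun q : ℂ × ℂ => q.1 ^ n * conj (q.2 ^ n)) (μ.prod ν) := by
      refine Integrable.of_bound (by fun_prop) 1 ?_
      filter_upwards [hcirc] with q hq
      simp [hq.1, hq.2]
    have h2 := integral_re hint
    simp only [RCLike.re_to_complex] at h2
    simp only [hF]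
    rw [integral_const_mul, h2, integral_prod_mul (fun z : ℂ => z ^ n) (fun w : ℂ => conj (w ^ n)),
      integral_conj, moment, moment]
  have hval : ∫ q, ∑' n, F n q ∂μ.prod ν = ∫ q, abelKernel r q ∂μ.prod ν := by
    refine integral_congr_ae ?_
    filter_upwards [hcirc] with q hq
    have hlt : ‖(r : ℂ) * (q.1 * conj q.2)‖ < 1 := by
      simpa [hq.1, hq.2, abs_of_nonneg h0] using h1
    have h2 := Complex.hasSum_re (Complex.hasSum_taylorSeries_neg_log hlt)
    rw [Complex.neg_re, Complex.log_re] at h2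
    rw [abelKernel, ← h2.tsum_eq]
    refine tsum_congr fun n => ?_
    have h3 : ((r : ℂ) * (q.1 * conj q.2)) ^ n / n =
        ((r ^ n / n : ℝ) : ℂ) * (q.1 ^ n * conj (q.2 ^ n)) := by
      push_cast
      rw [map_pow, mul_pow, mul_pow]
      ring
    rw [h3, Complex.re_ofReal_mul]
  simp only [hterm] at hmain
  rwa [hval] at hmain

theorem norm_sub_eq_norm_one_sub {z w : ℂ} (hw : ‖w‖ = 1) :
    ‖z - w‖ = ‖1 - z * conj w‖ := by
  have h : w * conj w = 1 := by
    rw [Complex.mul_conj, Complex.normSq_eq_norm_sq, hw]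
    norm_num
  have h2 : 1 - z * conj w = (w - z) * conj w := by rw [sub_mul, h]
  rw [h2, norm_mul, Complex.norm_conj, hw, mul_one, norm_sub_rev]

theorem abs_abelKernel_le {r : ℝ} (h0 : 0 ≤ r) (h1 : r < 1) {q : ℂ × ℂ} (hz : ‖q.1‖ = 1)
    (hw : ‖q.2‖ = 1) (hne : q.1 ≠ q.2) :
    |abelKernel r q| ≤ |logKernel q| + Real.log 2 := by
  set η := q.1 * conj q.2 with hη
  have hη1 : ‖η‖ = 1 := by simp [hη, hz, hw]
  have hrη : ‖(r : ℂ) * η‖ = r := by simp [hη1, abs_of_nonneg h0]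
  have h2 : 1 - r ≤ ‖1 - r * η‖ := by
    have := norm_sub_norm_le (1 : ℂ) (r * η)
    rwa [hrη, norm_one] at this
  have h3 : ‖1 - r * η‖ ≤ 2 := by
    refine (norm_sub_le _ _).trans ?_
    rw [hrη, norm_one]
    linarith
  have hpos : 0 < ‖1 - η‖ := by
    rw [hη, ← norm_sub_eq_norm_one_sub hw]
    exact norm_pos_iff.2 (sub_ne_zero.2 hne)
  have h4 : ‖1 - η‖ ≤ 2 * ‖1 - r * η‖ := by
    have h5 : 1 - η = (1 - r * η) - (1 - r : ℝ) * η := by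
      push_cast
      ring
    have h6 : ‖((1 - r : ℝ) : ℂ) * η‖ = 1 - r := by
      rw [norm_mul, hη1, mul_one, Complex.norm_real, Real.norm_eq_abs, abs_of_pos (by linarith)]
    rw [h5]
    refine (norm_sub_le _ _).trans ?_
    rw [h6]
    linarith
  have hl1 : Real.log ‖1 - r * η‖ ≤ Real.log 2 := Real.log_le_log (by linarith) h3
  have hl2 : Real.log ‖1 - η‖ ≤ Real.log 2 + Real.log ‖1 - r * η‖ := by
    rw [← Real.log_mul (by norm_num) (by linarith)]
    exact Real.log_le_log hpos h4
  have hk : logKernel q = -Real.log ‖1 - η‖ := by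
    rw [logKernel, norm_sub_eq_norm_one_sub hw]
  have hl3 : 0 ≤ Real.log 2 := Real.log_nonneg (by norm_num)
  rw [abs_le, abelKernel, ← hη]
  constructor
  · linarith [abs_nonneg (logKernel q)]
  · linarith [le_abs_self (logKernel q)]

theorem tendsto_integral_abelKernel [IsProbabilityMeasure μ] [IsProbabilityMeasure ν]
    (hμ : ∀ᵐ z ∂μ, ‖z‖ = 1) (hν : ∀ᵐ z ∂ν, ‖z‖ = 1) (hne : ∀ᵐ q ∂μ.prod ν, q.1 ≠ q.2)
    (hint : Integrable logKernel (μ.prod ν)) :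
    Tendsto (fun r => ∫ q, abelKernel r q ∂μ.prod ν) (𝓝[<] 1) (𝓝 (∫ q, logKernel q ∂μ.prod ν)) := by
  have hcirc := ae_prod_norm_eq_one hμ hν
  refine tendsto_integral_filter_of_dominated_convergence (fun q => |logKernel q| + Real.log 2)
    (Eventually.of_forall fun r => (measurable_abelKernel r).aestronglyMeasurable) ?_
    (hint.abs.add (integrable_const _)) ?_
  · filter_upwards [Ioo_mem_nhdsLT (zero_lt_one' ℝ)] with r hr
    filter_upwards [hcirc, hne] with q hq hq'
    exact abs_abelKernel_le hr.1.le hr.2 hq.1 hq.2 hq'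
  · filter_upwards [hcirc, hne] with q hq hq'
    have hk : logKernel q = abelKernel 1 q := by
      rw [logKernel, abelKernel, norm_sub_eq_norm_one_sub hq.2, Complex.ofReal_one, one_mul]
    have hc : ContinuousAt (fun r => abelKernel r q) 1 := by
      unfold abelKernel
      refine (ContinuousAt.log (by fun_prop) ?_).neg
      rw [Complex.ofReal_one, one_mul, ← norm_sub_eq_norm_one_sub hq.2]
      exact norm_ne_zero_iff.2 (sub_ne_zero.2 hq')
    rw [hk]
    exact hc.tendsto.mono_left nhdsWithin_le_nhds

/-- The energy of the difference of two probability measures on the circle is non-negative, and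
controls the differences of their moments. -/
theorem moment_sub_sq_le_energy [IsProbabilityMeasure μ] [IsProbabilityMeasure ν]
    (hμ : ∀ᵐ z ∂μ, ‖z‖ = 1) (hν : ∀ᵐ z ∂ν, ‖z‖ = 1)
    (hne1 : ∀ᵐ q ∂μ.prod μ, q.1 ≠ q.2) (hint1 : Integrable logKernel (μ.prod μ))
    (hne2 : ∀ᵐ q ∂μ.prod ν, q.1 ≠ q.2) (hint2 : Integrable logKernel (μ.prod ν))
    (hne3 : ∀ᵐ q ∂ν.prod ν, q.1 ≠ q.2) (hint3 : Integrable logKernel (ν.prod ν)) (n : ℕ) :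
    (n : ℝ)⁻¹ * ‖moment μ n - moment ν n‖ ^ 2 ≤ ∫ q, logKernel q ∂μ.prod μ
      - 2 * ∫ q, logKernel q ∂μ.prod ν + ∫ q, logKernel q ∂ν.prod ν := by
  have hlim := ((tendsto_integral_abelKernel hμ hμ hne1 hint1).sub
    ((tendsto_integral_abelKernel hμ hν hne2 hint2).const_mul 2)).add
    (tendsto_integral_abelKernel hν hν hne3 hint3)
  have hleft : Tendsto (fun r : ℝ => r ^ n / n * ‖moment μ n - moment ν n‖ ^ 2) (𝓝[<] 1)
      (𝓝 ((n : ℝ)⁻¹ * ‖moment μ n - moment ν n‖ ^ 2)) := by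
    have hc : Continuous fun r : ℝ => r ^ n / n * ‖moment μ n - moment ν n‖ ^ 2 := by fun_prop
    have := (hc.tendsto 1).mono_left (nhdsWithin_le_nhds (s := Set.Iio 1))
    simpa using this
  refine le_of_tendsto_of_tendsto hleft hlim ?_
  filter_upwards [Ioo_mem_nhdsLT (zero_lt_one' ℝ)] with r hr
  have hs := ((hasSum_integral_abelKernel hμ hμ hr.1.le hr.2).sub
    ((hasSum_integral_abelKernel hμ hν hr.1.le hr.2).mul_left 2)).add
    (hasSum_integral_abelKernel hν hν hr.1.le hr.2)
  have hterm : ∀ k : ℕ, r ^ k / k * (moment μ k * conj (moment μ k)).re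
      - 2 * (r ^ k / k * (moment μ k * conj (moment ν k)).re)
      + r ^ k / k * (moment ν k * conj (moment ν k)).re
      = r ^ k / k * ‖moment μ k - moment ν k‖ ^ 2 := by
    intro k
    rw [← Complex.normSq_eq_norm_sq, Complex.normSq_apply]
    simp only [Complex.mul_re, Complex.conj_re, Complex.conj_im, Complex.sub_re, Complex.sub_im]
    ring
  simp only [hterm] at hs
  have hr0 := hr.1
  exact le_hasSum hs n fun k _ => by positivity

/-! ### Measures on the unit circle are determined by their moments -/

theorem eq_of_moment_eq [IsProbabilityMeasure μ] [IsProbabilityMeasure ν]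
    (hμ : ∀ᵐ z ∂μ, ‖z‖ = 1) (hν : ∀ᵐ z ∂ν, ‖z‖ = 1) (h : ∀ n, moment μ n = moment ν n) :
    μ = ν := by
  have : Fact (0 < 2 * Real.pi) := ⟨Real.two_pi_pos⟩
  set A : ℂ → AddCircle (2 * Real.pi) := fun z => (z.arg : AddCircle (2 * Real.pi)) with hA
  have hAm : Measurable A := (AddCircle.measurable_mk').comp Complex.measurable_arg
  have hfour : ∀ n : ℤ, ∀ z : ℂ, ‖z‖ = 1 → fourier n (A z) = z ^ n := by
    intro n z hz
    rw [hA, fourier_coe_apply]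
    have h1 := Complex.norm_mul_exp_arg_mul_I z
    rw [hz, Complex.ofReal_one, one_mul] at h1
    nth_rw 2 [← h1]
    rw [← Complex.exp_int_mul]
    congr 1
    have : (Real.pi : ℂ) ≠ 0 := by exact_mod_cast Real.pi_ne_zero
    push_cast
    field_simp
  have hzpow : ∀ n : ℤ, ∫ z, z ^ n ∂μ = ∫ z, z ^ n ∂ν := by
    intro n
    obtain ⟨k, rfl | rfl⟩ := n.eq_nat_or_neg
    · simpa [moment] using h k
    · have hconj : ∀ z : ℂ, ‖z‖ = 1 → z ^ (-(k : ℤ)) = conj (z ^ k) := by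
        intro z hz
        rw [zpow_neg, zpow_natCast, map_pow, ← inv_pow, Complex.inv_def, Complex.normSq_eq_norm_sq,
          hz]
        simp
      rw [integral_congr_ae (hμ.mono hconj), integral_congr_ae (hν.mono hconj), integral_conj,
        integral_conj]
      exact congrArg conj (h k)
  have hint : ∀ (ρ : Measure ℂ) [IsProbabilityMeasure ρ] (g : C(AddCircle (2 * Real.pi), ℂ)),
      Integrable (fun z => g (A z)) ρ := fun ρ _ g =>
    Integrable.of_bound (g.continuous.measurable.comp hAm).aestronglyMeasurable ‖g‖
      (Eventually.of_forall fun z => g.norm_coe_le_norm _)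
  have hcont : ∀ (ρ : Measure ℂ) [IsProbabilityMeasure ρ],
      Continuous fun g : C(AddCircle (2 * Real.pi), ℂ) => ∫ z, g (A z) ∂ρ := by
    intro ρ _
    refine LipschitzWith.continuous (K := 1) (LipschitzWith.of_dist_le_mul fun f g => ?_)
    rw [dist_eq_norm, dist_eq_norm, ← integral_sub (hint ρ f) (hint ρ g), NNReal.coe_one, one_mul]
    refine (norm_integral_le_of_norm_le_const (C := ‖f - g‖)
      (Eventually.of_forall fun z => (f - g).norm_coe_le_norm _)).trans ?_
    simp
  let S : Submodule ℂ C(AddCircle (2 * Real.pi), ℂ) :=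
    { carrier := {g | ∫ z, g (A z) ∂μ = ∫ z, g (A z) ∂ν}
      add_mem' := fun {f g} hf hg => by
        simp only [Set.mem_ofPred_eq, ContinuousMap.add_apply] at hf hg ⊢
        rw [integral_add (hint μ f) (hint μ g), integral_add (hint ν f) (hint ν g), hf, hg]
      zero_mem' := by simp
      smul_mem' := fun c f hf => by
        simp only [Set.mem_ofPred_eq, ContinuousMap.smul_apply, smul_eq_mul] at hf ⊢
        rw [integral_const_mul, integral_const_mul, hf] }
  have hS : ∀ g : C(AddCircle (2 * Real.pi), ℂ), ∫ z, g (A z) ∂μ = ∫ z, g (A z) ∂ν := by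
    intro g
    have hle : (Submodule.span ℂ (Set.range (@fourier (2 * Real.pi)))).topologicalClosure ≤ S := by
      refine Submodule.topologicalClosure_minimal _ ?_ (isClosed_eq (hcont μ) (hcont ν))
      rw [Submodule.span_le]
      rintro _ ⟨n, rfl⟩
      change ∫ z, fourier n (A z) ∂μ = ∫ z, fourier n (A z) ∂ν
      rw [integral_congr_ae (hμ.mono (hfour n)), integral_congr_ae (hν.mono (hfour n))]
      exact hzpow n
    rw [span_fourier_closure_eq_top] at hle
    exact hle (Submodule.mem_top (x := g))
  refine ext_of_forall_integral_eq_of_IsFiniteMeasure fun f => ?_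
  let g : C(AddCircle (2 * Real.pi), ℂ) :=
    ⟨fun t => ((f (fourier 1 t) : ℝ) : ℂ), by fun_prop⟩
  have hg : ∀ z : ℂ, ‖z‖ = 1 → g (A z) = (f z : ℂ) := fun z hz => by
    change ((f (fourier 1 (A z)) : ℝ) : ℂ) = f z
    rw [hfour 1 z hz, zpow_one]
  have h1 := hS g
  rw [integral_congr_ae (hμ.mono hg), integral_congr_ae (hν.mono hg),
    integral_complex_ofReal, integral_complex_ofReal] at h1
  exact_mod_cast h1

/-! ### Measures with constant potential -/

theorem ae_ne_prod [SFinite μ] [SFinite ν] (hν : ∀ z, ν {z} = 0) : ∀ᵐ q ∂μ.prod ν, q.1 ≠ q.2 := by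
  have hm : MeasurableSet {q : ℂ × ℂ | q.1 = q.2} := measurableSet_diagonal
  rw [ae_iff]
  simp only [ne_eq, not_not]
  rw [Measure.measure_prod_null hm]
  refine Eventually.of_forall fun z => ?_
  have : Prod.mk z ⁻¹' {q : ℂ × ℂ | q.1 = q.2} = {z} := by
    ext w
    simp [eq_comm]
  change ν (Prod.mk z ⁻¹' {q : ℂ × ℂ | q.1 = q.2}) = 0
  rw [this]
  exact hν z

theorem integrable_logKernel_of_potential [IsProbabilityMeasure μ] [IsProbabilityMeasure ν]
    {K : Set ℂ} (hK : ∀ z ∈ K, ‖z‖ = 1) (hμ : μ Kᶜ = 0) (hν : ν Kᶜ = 0) {V : ℝ}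
    (hpot : ∀ z ∈ K, Integrable (fun w => logKernel (z, w)) ν ∧ ∫ w, logKernel (z, w) ∂ν = V) :
    Integrable logKernel (μ.prod ν) ∧ ∫ q, logKernel q ∂μ.prod ν = V := by
  have hμK : ∀ᵐ z ∂μ, z ∈ K := mem_ae_iff.2 hμ
  have hν1 := ae_norm_eq_one hK hν
  have hsm : AEStronglyMeasurable logKernel (μ.prod ν) := measurable_logKernel.aestronglyMeasurable
  have hint : Integrable logKernel (μ.prod ν) := by
    rw [integrable_prod_iff hsm]
    refine ⟨hμK.mono fun z hz => (hpot z hz).1, ?_⟩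
    refine Integrable.of_bound hsm.norm.integral_prod_right' (V + 2 * Real.log 2) ?_
    filter_upwards [hμK] with z hz
    obtain ⟨h1, h2⟩ := hpot z hz
    rw [Real.norm_eq_abs, abs_of_nonneg (integral_nonneg fun w => norm_nonneg _)]
    calc ∫ w, ‖logKernel (z, w)‖ ∂ν ≤ ∫ w, (logKernel (z, w) + 2 * Real.log 2) ∂ν := by
          refine integral_mono_ae h1.norm (h1.add (integrable_const _)) ?_
          filter_upwards [hν1] with w hw
          have h3 := neg_log_two_le_logKernel (hK z hz) hw
          have h4 : 0 ≤ Real.log 2 := Real.log_nonneg (by norm_num)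
          rw [Real.norm_eq_abs, abs_le]
          constructor <;> linarith
      _ = V + 2 * Real.log 2 := by
          rw [integral_add h1 (integrable_const _), h2]
          simp
  refine ⟨hint, ?_⟩
  rw [integral_prod _ hint, integral_congr_ae (hμK.mono fun z hz => (hpot z hz).2)]
  simp

/-- Frostman's criterion on the circle: a measure without atoms whose potential is constant on `K`
is the only equilibrium measure of `K`. -/
theorem isEquilibriumMeasure_iff_of_potential [IsProbabilityMeasure ν]
    {K : Set ℂ} (hK : ∀ z ∈ K, ‖z‖ = 1) (hν : ν Kᶜ = 0) (hatom : ∀ z, ν {z} = 0) {V : ℝ}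
    (hpot : ∀ z ∈ K, Integrable (fun w => logKernel (z, w)) ν ∧ ∫ w, logKernel (z, w) ∂ν = V) :
    IsEquilibriumMeasure K μ ↔ μ = ν := by
  obtain ⟨hint3, hval3⟩ := integrable_logKernel_of_potential (μ := ν) hK hν hν hpot
  have hne3 := ae_ne_prod (μ := ν) hatom
  have hν1 := ae_norm_eq_one hK hν
  have hVν : logEnergy ν = (V : EReal) := by rw [logEnergy_eq_integral hne3 hint3, hval3]
  have key : ∀ ρ : Measure ℂ, IsProbabilityMeasure ρ → ρ Kᶜ = 0 → logEnergy ρ < ⊤ →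
      ∃ E : ℝ, logEnergy ρ = E ∧
        ∀ n : ℕ, (n : ℝ)⁻¹ * ‖moment ρ n - moment ν n‖ ^ 2 ≤ E - V := by
    intro ρ _ hρ hfin
    have hρ1 := ae_norm_eq_one hK hρ
    obtain ⟨hne1, hint1⟩ := ae_ne_of_logEnergy_lt_top hρ1 hfin
    obtain ⟨hint2, hval2⟩ := integrable_logKernel_of_potential (μ := ρ) hK hρ hν hpot
    refine ⟨_, logEnergy_eq_integral hne1 hint1, fun n => ?_⟩
    have := moment_sub_sq_le_energy hρ1 hν1 hne1 hint1 (ae_ne_prod hatom) hint2 hne3 hint3 n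
    rw [hval2, hval3] at this
    linarith
  constructor
  · intro h
    have := h.prob
    obtain ⟨E, hE, hmom⟩ := key μ h.prob h.carried h.finite_energy
    have hle := h.minimal ν inferInstance hν
    rw [hE, hVν, EReal.coe_le_coe_iff] at hle
    refine eq_of_moment_eq (ae_norm_eq_one hK h.carried) hν1 fun n => ?_
    rcases n.eq_zero_or_pos with rfl | hn
    · simp [moment]
    · have h1 := hmom n
      have h2 : (0 : ℝ) < (n : ℝ)⁻¹ := by positivity
      have h3 : ‖moment μ n - moment ν n‖ ^ 2 ≤ 0 := by
        by_contra! hcon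
        have := mul_pos h2 hcon
        linarith
      have h4 : ‖moment μ n - moment ν n‖ = 0 := by
        have := sq_nonneg ‖moment μ n - moment ν n‖
        exact pow_eq_zero_iff (two_ne_zero) |>.1 (le_antisymm h3 this)
      exact sub_eq_zero.1 (norm_eq_zero.1 h4)
  · rintro rfl
    refine ⟨inferInstance, hν, ?_, fun ρ hρ hρK => ?_⟩
    · rw [hVν]
      exact EReal.coe_lt_top V
    · rcases lt_or_ge (logEnergy ρ) ⊤ with hfin | hfin
      · obtain ⟨E, hE, hmom⟩ := key ρ hρ hρK hfin
        -- For `n = 0` the left side is `0`, because `0⁻¹ = 0`.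
        have := hmom 0
        simp only [Nat.cast_zero, inv_zero, zero_mul] at this
        rw [hVν, hE, EReal.coe_le_coe_iff]
        linarith
      · exact le_top.trans hfin

/-! ### The equilibrium measure of the bands -/

theorem norm_circlePt_sub_mul (s t : ℝ) :
    ‖circlePt t - circlePt s‖ * ‖circlePt t - circlePt (-s)‖ = |2 * Real.cos s - 2 * Real.cos t| := by
  have h1 : circlePt s * circlePt (-s) = 1 := by
    rw [circlePt, circlePt, ← Complex.exp_add]
    simp
  have h1' : circlePt t * circlePt (-t) = 1 := by
    rw [circlePt, circlePt, ← Complex.exp_add]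
    simp
  have h2 : ∀ r : ℝ, circlePt r + circlePt (-r) = ((2 * Real.cos r : ℝ) : ℂ) := fun r => by
    rw [circlePt, circlePt]
    push_cast
    rw [Complex.two_cos, neg_mul]
  have h3 : (circlePt t - circlePt s) * (circlePt t - circlePt (-s)) =
      circlePt t * -((2 * Real.cos s - 2 * Real.cos t : ℝ) : ℂ) := by
    rw [Complex.ofReal_sub, ← h2, ← h2]
    linear_combination h1 - h1'
  rw [← norm_mul, h3, norm_mul, norm_circlePt, one_mul, norm_neg, Complex.norm_real,
    Real.norm_eq_abs]

theorem intervalIntegrable_log_norm_circlePt_sub (w : ℂ) :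
    IntervalIntegrable (fun t => Real.log ‖circlePt t - w‖) volume 0 (2 * Real.pi) := by
  have h := circleIntegrable_log_norm_sub_const (a := w) (c := 0) 1
  have he : (fun t => Real.log ‖circlePt t - w‖) = fun t => Real.log ‖circleMap 0 1 t - w‖ := by
    funext t
    simp [circlePt, circleMap]
  rw [he]
  exact h

theorem integral_log_norm_circlePt_sub {w : ℂ} (hw : ‖w‖ = 1) :
    ∫ t in (0)..(2 * Real.pi), Real.log ‖circlePt t - w‖ = 0 := by
  have h := circleAverage_log_norm_sub_const₁ hw
  rw [Real.circleAverage_def, smul_eq_mul, mul_eq_zero] at h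
  have hpi := Real.pi_pos
  have h2 := h.resolve_left (by positivity)
  have he : (fun t => Real.log ‖circlePt t - w‖) = fun t => Real.log ‖circleMap 0 1 t - w‖ := by
    funext t
    simp [circlePt, circleMap]
  rw [he]
  exact h2

/-- The logarithm of `|2 cos s - 2 cos t|`, split into its two singular parts. -/
noncomputable def logCosDiff (s t : ℝ) : ℝ :=
  Real.log ‖circlePt t - circlePt s‖ + Real.log ‖circlePt t - circlePt (-s)‖

theorem intervalIntegrable_logCosDiff (s : ℝ) :
    IntervalIntegrable (logCosDiff s) volume 0 (2 * Real.pi) :=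
  (intervalIntegrable_log_norm_circlePt_sub _).add (intervalIntegrable_log_norm_circlePt_sub _)

theorem conj_circlePt (t : ℝ) : conj (circlePt t) = circlePt (-t) := by
  rw [circlePt, circlePt, ← Complex.exp_conj]
  simp

theorem logCosDiff_two_pi_sub (s t : ℝ) : logCosDiff s (2 * Real.pi - t) = logCosDiff s t := by
  have h : circlePt (2 * Real.pi - t) = circlePt (-t) := by
    rw [← circlePt_add_two_pi (-t)]
    congr 1
    ring
  have h1 : ‖circlePt (-t) - circlePt s‖ = ‖circlePt t - circlePt (-s)‖ := by
    rw [← conj_circlePt t, ← Complex.norm_conj (circlePt t - circlePt (-s)), map_sub,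
      conj_circlePt (-s), neg_neg]
  have h2 : ‖circlePt (-t) - circlePt (-s)‖ = ‖circlePt t - circlePt s‖ := by
    rw [← conj_circlePt t, ← conj_circlePt s, ← map_sub, Complex.norm_conj]
  rw [logCosDiff, logCosDiff, h, h1, h2, add_comm]

/-- The arcsine distribution of `[-2, 2]` has vanishing potential on `[-2, 2]`. -/
theorem setIntegral_logCosDiff (s : ℝ) :
    IntegrableOn (logCosDiff s) (Set.Ioo 0 Real.pi) ∧
      ∫ t in Set.Ioo 0 Real.pi, logCosDiff s t = 0 := by
  have hpi := Real.pi_pos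
  have hint := intervalIntegrable_logCosDiff s
  have h1 : IntervalIntegrable (logCosDiff s) volume 0 Real.pi :=
    hint.mono_set (by
      rw [Set.uIcc_of_le (by linarith), Set.uIcc_of_le (by linarith)]
      exact Set.Icc_subset_Icc le_rfl (by linarith))
  have h2 : IntervalIntegrable (logCosDiff s) volume Real.pi (2 * Real.pi) :=
    hint.mono_set (by
      rw [Set.uIcc_of_le (by linarith), Set.uIcc_of_le (by linarith)]
      exact Set.Icc_subset_Icc hpi.le le_rfl)
  have h3 : ∫ t in (0)..(2 * Real.pi), logCosDiff s t = 0 := by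
    unfold logCosDiff
    rw [intervalIntegral.integral_add (intervalIntegrable_log_norm_circlePt_sub _)
      (intervalIntegrable_log_norm_circlePt_sub _),
      integral_log_norm_circlePt_sub (norm_circlePt s),
      integral_log_norm_circlePt_sub (norm_circlePt _), add_zero]
  have h4 : ∫ t in Real.pi..(2 * Real.pi), logCosDiff s t = ∫ t in (0)..Real.pi, logCosDiff s t := by
    have h5 := intervalIntegral.integral_comp_sub_left (a := 0) (b := Real.pi) (logCosDiff s)
      (2 * Real.pi)
    simp only [logCosDiff_two_pi_sub, sub_zero] at h5
    rw [h5]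
    congr 1
    ring
  rw [← intervalIntegral.integral_add_adjacent_intervals h1 h2, h4] at h3
  constructor
  · rw [intervalIntegrable_iff_integrableOn_Ioc_of_le hpi.le] at h1
    exact h1.mono_set Set.Ioo_subset_Ioc_self
  · rw [← integral_Ioc_eq_integral_Ioo, ← intervalIntegral.integral_of_le hpi.le]
    linarith

theorem IsBand.levelPt_strictMonoOn_or {α : ℕ → ℂ} (hα : ∀ n, ‖α n‖ < 1) {p : ℕ} (hp : 0 < p)
    {a b : ℝ} (h : IsBand α p a b) :
    StrictMonoOn (levelPt α p a b) (Set.Ioo 0 Real.pi) ∨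
      StrictAntiOn (levelPt α p a b) (Set.Ioo 0 Real.pi) := by
  have hcos : ∀ s ∈ Set.Ioo 0 Real.pi, ∀ t ∈ Set.Ioo 0 Real.pi, s < t →
      realDisc α p (levelPt α p a b t) < realDisc α p (levelPt α p a b s) := by
    intro s hs t ht hst
    rw [(h.levelPt_spec hα hp t).2, (h.levelPt_spec hα hp s).2]
    have := Real.strictAntiOn_cos (Set.Ioo_subset_Icc_self hs) (Set.Ioo_subset_Icc_self ht) hst
    linarith
  rcases h.dichotomy hα hp with ⟨-, hm, -⟩ | ⟨-, hm, -⟩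
  · refine Or.inl fun s hs t ht hst => ?_
    exact (hm.lt_iff_gt (h.levelPt_spec hα hp t).1 (h.levelPt_spec hα hp s).1).1 (hcos s hs t ht hst)
  · refine Or.inr fun s hs t ht hst => ?_
    exact (hm.lt_iff_lt (h.levelPt_spec hα hp t).1 (h.levelPt_spec hα hp s).1).1 (hcos s hs t ht hst)

theorem IsBand.aemeasurable_levelPt {α : ℕ → ℂ} (hα : ∀ n, ‖α n‖ < 1) {p : ℕ} (hp : 0 < p)
    {a b : ℝ} (h : IsBand α p a b) :
    AEMeasurable (levelPt α p a b) (volume.restrict (Set.Ioo 0 Real.pi)) := by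
  rcases h.levelPt_strictMonoOn_or hα hp with hm | hm
  · exact aemeasurable_restrict_of_monotoneOn measurableSet_Ioo hm.monotoneOn
  · exact aemeasurable_restrict_of_antitoneOn measurableSet_Ioo hm.antitoneOn

theorem IsBand.aemeasurable_circlePt_levelPt {α : ℕ → ℂ} (hα : ∀ n, ‖α n‖ < 1) {p : ℕ} (hp : 0 < p)
    {a b : ℝ} (h : IsBand α p a b) :
    AEMeasurable (fun t => circlePt (levelPt α p a b t)) (volume.restrict (Set.Ioo 0 Real.pi)) :=
  continuous_circlePt.measurable.comp_aemeasurable (h.aemeasurable_levelPt hα hp)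

/-- The pullback of the arcsine distribution of `[-2, 2]` under `Δ`, which gives mass `1 / p` to
each band: on the `j`-th band it is the image of the uniform distribution of `t ∈ (0, π)` under
the inverse of `Δ = 2 cos t`. -/
noncomputable def bandMeasure (α : ℕ → ℂ) (p : ℕ) (x y : ℕ → ℝ) : Measure ℂ :=
  ∑ j ∈ Finset.Icc 1 p, ENNReal.ofReal (p * Real.pi)⁻¹ •
    Measure.map (fun t => circlePt (levelPt α p (x j) (y j) t)) (volume.restrict (Set.Ioo 0 Real.pi))

/-- The length of the set of parameters in `(0, π)` of those points of the band `[a, b]` that lie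
to the left of `φ`. -/
noncomputable def bandParam (α : ℕ → ℂ) (p : ℕ) (a b φ : ℝ) : ℝ :=
  volume.real (Set.Ioo 0 Real.pi ∩ {t | levelPt α p a b t < φ})

theorem IsBand.bandParam_eq_zero {α : ℕ → ℂ} (hα : ∀ n, ‖α n‖ < 1) {p : ℕ} (hp : 0 < p)
    {a b : ℝ} (h : IsBand α p a b) {φ : ℝ} (hφ : φ ≤ a) : bandParam α p a b φ = 0 := by
  have : Set.Ioo 0 Real.pi ∩ {t | levelPt α p a b t < φ} = ∅ := by
    ext t
    simp only [Set.mem_inter_iff, Set.mem_ofPred_eq, Set.mem_empty_iff_false, iff_false, not_and,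
      not_lt]
    intro ht
    exact hφ.trans (h.levelPt_mem_Ioo hα hp ht).1.le
  rw [bandParam, this, measureReal_empty]

theorem IsBand.bandParam_eq_pi {α : ℕ → ℂ} (hα : ∀ n, ‖α n‖ < 1) {p : ℕ} (hp : 0 < p)
    {a b : ℝ} (h : IsBand α p a b) {φ : ℝ} (hφ : b ≤ φ) : bandParam α p a b φ = Real.pi := by
  have : Set.Ioo 0 Real.pi ∩ {t | levelPt α p a b t < φ} = Set.Ioo 0 Real.pi := by
    rw [Set.inter_eq_left]
    intro t ht
    exact (h.levelPt_mem_Ioo hα hp ht).2.trans_le hφ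
  rw [bandParam, this, Real.volume_real_Ioo_of_le Real.pi_pos.le, sub_zero]

theorem IsBand.bandParam_levelPt {α : ℕ → ℂ} (hα : ∀ n, ‖α n‖ < 1) {p : ℕ} (hp : 0 < p)
    {a b : ℝ} (h : IsBand α p a b) :
    (∀ s ∈ Set.Ioo 0 Real.pi, bandParam α p a b (levelPt α p a b s) = s) ∨
      ∀ s ∈ Set.Ioo 0 Real.pi, bandParam α p a b (levelPt α p a b s) = Real.pi - s := by
  refine (h.levelPt_strictMonoOn_or hα hp).imp (fun hm s hs => ?_) fun hm s hs => ?_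
  · have : Set.Ioo 0 Real.pi ∩ {t | levelPt α p a b t < levelPt α p a b s} = Set.Ioo 0 s := by
      ext t
      simp only [Set.mem_inter_iff, Set.mem_ofPred_eq, Set.mem_Ioo]
      constructor
      · rintro ⟨ht, hlt⟩
        exact ⟨ht.1, (hm.lt_iff_lt ht hs).1 hlt⟩
      · rintro ⟨h0, hlt⟩
        have ht : t ∈ Set.Ioo 0 Real.pi := ⟨h0, hlt.trans hs.2⟩
        exact ⟨ht, hm ht hs hlt⟩
    rw [bandParam, this, Real.volume_real_Ioo_of_le hs.1.le, sub_zero]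
  · have : Set.Ioo 0 Real.pi ∩ {t | levelPt α p a b t < levelPt α p a b s} = Set.Ioo s Real.pi := by
      ext t
      simp only [Set.mem_inter_iff, Set.mem_ofPred_eq, Set.mem_Ioo]
      constructor
      · rintro ⟨ht, hlt⟩
        exact ⟨(hm.lt_iff_gt ht hs).1 hlt, ht.2⟩
      · rintro ⟨hlt, h1⟩
        have ht : t ∈ Set.Ioo 0 Real.pi := ⟨hs.1.trans hlt, h1⟩
        exact ⟨ht, hm hs ht hlt⟩
    rw [bandParam, this, Real.volume_real_Ioo_of_le hs.2.le]

theorem IsBand.exists_levelPt_eq {α : ℕ → ℂ} (hα : ∀ n, ‖α n‖ < 1) {p : ℕ} (hp : 0 < p)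
    {a b : ℝ} (h : IsBand α p a b) {φ : ℝ} (hφ : φ ∈ Set.Ioo a b) :
    ∃ s ∈ Set.Ioo 0 Real.pi, levelPt α p a b s = φ := by
  have h1 := abs_lt.1 (h.interior φ hφ)
  refine ⟨Real.arccos (realDisc α p φ / 2), ⟨Real.arccos_pos.2 (by linarith), ?_⟩, ?_⟩
  · refine (Real.arccos_le_pi _).lt_of_ne fun he => ?_
    rw [Real.arccos_eq_pi] at he
    linarith
  · refine h.levelPt_eq hα hp (Set.Ioo_subset_Icc_self hφ) ?_
    rw [Real.cos_arccos (by linarith) (by linarith)]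
    ring

namespace IsBandSystem

variable {α : ℕ → ℂ} {p : ℕ} {x y : ℕ → ℝ}

theorem bandMeasure_apply (h : IsBandSystem α p x y) (hα : ∀ n, ‖α n‖ < 1) (hp : 0 < p)
    {s : Set ℂ} (hs : MeasurableSet s) :
    bandMeasure α p x y s = ∑ j ∈ Finset.Icc 1 p, ENNReal.ofReal (p * Real.pi)⁻¹ *
      volume ({t | circlePt (levelPt α p (x j) (y j) t) ∈ s} ∩ Set.Ioo 0 Real.pi) := by
  rw [bandMeasure, Measure.finsetSum_apply]
  refine Finset.sum_congr rfl fun j hj => ?_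
  rw [Measure.smul_apply, smul_eq_mul, Measure.map_apply_of_aemeasurable
    ((h.band j (Finset.mem_Icc.1 hj)).aemeasurable_circlePt_levelPt hα hp) hs,
    Measure.restrict_apply' measurableSet_Ioo]
  rfl

theorem isProbabilityMeasure_bandMeasure (h : IsBandSystem α p x y) (hα : ∀ n, ‖α n‖ < 1)
    (hp : 0 < p) : IsProbabilityMeasure (bandMeasure α p x y) := by
  constructor
  have hpi := Real.pi_pos
  have hp' : (0 : ℝ) < p := by exact_mod_cast hp
  rw [h.bandMeasure_apply hα hp MeasurableSet.univ]
  simp only [Set.mem_univ, Set.ofPred_true, Set.univ_inter, Real.volume_Ioo, sub_zero,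
    Finset.sum_const, Nat.card_Icc, add_tsub_cancel_right, nsmul_eq_mul]
  rw [← ENNReal.ofReal_mul (by positivity), ← ENNReal.ofReal_natCast,
    ← ENNReal.ofReal_mul hp'.le, ← ENNReal.ofReal_one]
  congr 1
  field_simp

theorem measurableSet_bandSet (h : IsBandSystem α p x y) (hα : ∀ n, ‖α n‖ < 1) (hp : 0 < p)
    (hpe : Even p) : MeasurableSet (bandSet α p) := by
  have he : bandSet α p = ⋃ j ∈ Finset.Icc 1 p, circlePt '' Set.Icc (x j) (y j) := by
    ext z
    simp only [Set.mem_iUnion, Set.mem_image]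
    constructor
    · intro hz
      obtain ⟨θ, -, rfl⟩ := exists_circlePt_eq hz.1 0
      obtain ⟨j, hj, φ, hφ, he⟩ :=
        h.exists_mem_band hα hp hpe ((circlePt_mem_bandSet_iff α hpe θ).1 hz)
      exact ⟨j, Finset.mem_Icc.2 hj, φ, hφ, he⟩
    · rintro ⟨j, hj, θ, hθ, rfl⟩
      exact (circlePt_mem_bandSet_iff α hpe θ).2 ((h.band j (Finset.mem_Icc.1 hj)).abs_le hθ)
  rw [he]
  exact (Finset.isCompact_biUnion _ fun j _ =>
    isCompact_Icc.image continuous_circlePt).isClosed.measurableSet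

theorem bandMeasure_compl_bandSet (h : IsBandSystem α p x y) (hα : ∀ n, ‖α n‖ < 1) (hp : 0 < p)
    (hpe : Even p) : bandMeasure α p x y (bandSet α p)ᶜ = 0 := by
  rw [h.bandMeasure_apply hα hp (h.measurableSet_bandSet hα hp hpe).compl]
  refine Finset.sum_eq_zero fun j hj => ?_
  have hb := h.band j (Finset.mem_Icc.1 hj)
  have : {t | circlePt (levelPt α p (x j) (y j) t) ∈ (bandSet α p)ᶜ} = ∅ := by
    ext t
    simp only [Set.mem_ofPred_eq, Set.mem_compl_iff, Set.mem_empty_iff_false, iff_false, not_not]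
    exact (circlePt_mem_bandSet_iff α hpe _).2 (hb.abs_le (hb.levelPt_spec hα hp t).1)
  rw [this, Set.empty_inter, measure_empty, mul_zero]

theorem bandMeasure_singleton (h : IsBandSystem α p x y) (hα : ∀ n, ‖α n‖ < 1) (hp : 0 < p)
    (hpe : Even p) (z : ℂ) : bandMeasure α p x y {z} = 0 := by
  rw [h.bandMeasure_apply hα hp (measurableSet_singleton z)]
  refine Finset.sum_eq_zero fun j hj => ?_
  have hb := h.band j (Finset.mem_Icc.1 hj)
  have : ({t | circlePt (levelPt α p (x j) (y j) t) ∈ ({z} : Set ℂ)} ∩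
      Set.Ioo 0 Real.pi).Subsingleton := by
    rintro s ⟨hs1, hs2⟩ t ⟨ht1, ht2⟩
    have he : circlePt (levelPt α p (x j) (y j) s) = circlePt (levelPt α p (x j) (y j) t) :=
      (Set.mem_singleton_iff.1 hs1).trans (Set.mem_singleton_iff.1 ht1).symm
    have hd := discriminant_circlePt α hpe (levelPt α p (x j) (y j) s)
    rw [he, discriminant_circlePt α hpe, (hb.levelPt_spec hα hp s).2,
      (hb.levelPt_spec hα hp t).2] at hd
    have hcos := mul_left_cancel₀ two_ne_zero (Complex.ofReal_injective hd)
    exact (Real.injOn_cos (Set.Ioo_subset_Icc_self ht2) (Set.Ioo_subset_Icc_self hs2) hcos).symm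
  rw [this.measure_zero, mul_zero]

/-- The product formula turns the potential of the bands into the potential of the arcsine
distribution at the point `Δ(z)` of `[-2, 2]`. -/
theorem bandMeasure_potential (h : IsBandSystem α p x y) (hα : ∀ n, ‖α n‖ < 1) (hp : 0 < p)
    (hpe : Even p) {z : ℂ} (hz : z ∈ bandSet α p) :
    Integrable (fun w => logKernel (z, w)) (bandMeasure α p x y) ∧
      ∫ w, logKernel (z, w) ∂bandMeasure α p x y = -(Real.log (rhoProd α p) / p) := by
  have hpi := Real.pi_pos
  have hp' : (0 : ℝ) < p := by exact_mod_cast hp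
  have hR := rhoProd_pos hα p
  obtain ⟨θ, -, rfl⟩ := exists_circlePt_eq hz.1 0
  have hD := abs_le.1 ((circlePt_mem_bandSet_iff α hpe θ).1 hz)
  set s := Real.arccos (realDisc α p θ / 2) with hs
  have hcos : realDisc α p θ = 2 * Real.cos s := by
    rw [hs, Real.cos_arccos (by linarith) (by linarith)]
    ring
  have hs_mem : s ∈ Set.Icc 0 Real.pi := ⟨Real.arccos_nonneg _, Real.arccos_le_pi _⟩
  obtain ⟨hgint, hgval⟩ := setIntegral_logCosDiff s
  set H : ℕ → ℝ → ℝ := fun j t => Real.log ‖circlePt θ - circlePt (levelPt α p (x j) (y j) t)‖ with hH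
  have hae : ∀ᵐ t ∂volume.restrict (Set.Ioo 0 Real.pi), t ∈ Set.Ioo 0 Real.pi ∧ t ≠ s :=
    (ae_restrict_mem measurableSet_Ioo).and (ae_restrict_of_ae (Measure.ae_ne volume s))
  have hsum : ∀ᵐ t ∂volume.restrict (Set.Ioo 0 Real.pi),
      ∑ j ∈ Finset.Icc 1 p, H j t = Real.log (rhoProd α p) + logCosDiff s t := by
    filter_upwards [hae] with t ht
    have h1 := congrArg norm (h.levelPoly_eval_eq_prod hα hp hpe ht.1 (circlePt θ))
    rw [levelPoly_eval_circlePt hα hpe, norm_mul, norm_pow, norm_circlePt, one_pow, one_mul,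
      Complex.norm_real, Real.norm_eq_abs, abs_mul, abs_of_pos hR, hcos, norm_prod,
      ← norm_circlePt_sub_mul] at h1
    have hne : 2 * Real.cos s - 2 * Real.cos t ≠ 0 := fun h0 =>
      ht.2 (Real.injOn_cos (Set.Ioo_subset_Icc_self ht.1) hs_mem (by linarith))
    have h2 : ‖circlePt t - circlePt s‖ * ‖circlePt t - circlePt (-s)‖ ≠ 0 := by
      rw [norm_circlePt_sub_mul]
      exact abs_ne_zero.2 hne
    have h3 : ∏ j ∈ Finset.Icc 1 p, ‖circlePt θ - circlePt (levelPt α p (x j) (y j) t)‖ ≠ 0 := by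
      rw [← h1]
      exact mul_ne_zero hR.ne' h2
    rw [← Real.log_prod (Finset.prod_ne_zero_iff.1 h3), ← h1, Real.log_mul hR.ne' h2,
      Real.log_mul (left_ne_zero_of_mul h2) (right_ne_zero_of_mul h2), logCosDiff]
  have hle : ∀ j t, H j t ≤ Real.log 2 := fun j t => by
    have := neg_log_two_le_logKernel (norm_circlePt θ) (norm_circlePt (levelPt α p (x j) (y j) t))
    rw [logKernel, neg_le_neg_iff] at this
    exact this
  have hl2 : 0 ≤ Real.log 2 := Real.log_nonneg (by norm_num)
  have hHint : ∀ j ∈ Finset.Icc 1 p, IntegrableOn (H j) (Set.Ioo 0 Real.pi) := by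
    intro j hj
    have hm := (h.band j (Finset.mem_Icc.1 hj)).aemeasurable_circlePt_levelPt hα hp
    have hHm : AEMeasurable (H j) (volume.restrict (Set.Ioo 0 Real.pi)) :=
      Real.measurable_log.comp_aemeasurable ((hm.const_sub _).norm)
    refine Integrable.mono' (g := fun t => |Real.log (rhoProd α p) + logCosDiff s t| + p * Real.log 2)
      (((integrable_const _).add hgint).abs.add (integrable_const _)) hHm.aestronglyMeasurable ?_
    filter_upwards [hsum] with t ht
    have h1 : ∑ k ∈ (Finset.Icc 1 p).erase j, H k t ≤ p * Real.log 2 := by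
      refine (Finset.sum_le_card_nsmul _ _ _ fun k _ => hle k t).trans ?_
      rw [nsmul_eq_mul]
      gcongr
      exact Finset.card_erase_le.trans (by simp)
    have h2 := Finset.add_sum_erase (Finset.Icc 1 p) (fun k => H k t) hj
    have h3 := neg_abs_le (Real.log (rhoProd α p) + logCosDiff s t)
    have h4 : Real.log 2 ≤ p * Real.log 2 := by
      have : (1 : ℝ) ≤ p := by exact_mod_cast hp
      nlinarith
    have h5 := abs_nonneg (Real.log (rhoProd α p) + logCosDiff s t)
    rw [Real.norm_eq_abs, abs_le]
    constructor
    · linarith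
    · linarith [hle j t]
  have hkm : Measurable fun w => logKernel (circlePt θ, w) :=
    measurable_logKernel.comp measurable_prodMk_left
  have hcomp : ∀ j ∈ Finset.Icc 1 p, Integrable (fun w => logKernel (circlePt θ, w))
      (Measure.map (fun t => circlePt (levelPt α p (x j) (y j) t))
        (volume.restrict (Set.Ioo 0 Real.pi))) := fun j hj => by
    rw [integrable_map_measure hkm.aestronglyMeasurable
      ((h.band j (Finset.mem_Icc.1 hj)).aemeasurable_circlePt_levelPt hα hp)]
    exact (hHint j hj).neg
  have hcomp' := fun j hj => (hcomp j hj).smul_measure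
    (ENNReal.ofReal_ne_top (r := ((p : ℝ) * Real.pi)⁻¹))
  constructor
  · rw [bandMeasure]
    exact integrable_finsetSum_measure.2 hcomp'
  · rw [bandMeasure, integral_finsetSum_measure hcomp']
    have hterm : ∀ j ∈ Finset.Icc 1 p, ∫ w, logKernel (circlePt θ, w) ∂(ENNReal.ofReal
        (p * Real.pi)⁻¹ • Measure.map (fun t => circlePt (levelPt α p (x j) (y j) t))
          (volume.restrict (Set.Ioo 0 Real.pi))) =
        -(p * Real.pi)⁻¹ * ∫ t in Set.Ioo 0 Real.pi, H j t := by
      intro j hj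
      rw [integral_smul_measure, integral_map
        ((h.band j (Finset.mem_Icc.1 hj)).aemeasurable_circlePt_levelPt hα hp)
        hkm.aestronglyMeasurable, ENNReal.toReal_ofReal (by positivity), smul_eq_mul, neg_mul,
        ← mul_neg, ← integral_neg]
      rfl
    rw [Finset.sum_congr rfl hterm, ← Finset.mul_sum, ← integral_finsetSum _ hHint,
      integral_congr_ae hsum, integral_add (integrable_const _) hgint, hgval, setIntegral_const,
      Real.volume_real_Ioo_of_le hpi.le, sub_zero, add_zero, smul_eq_mul]
    field_simp

theorem isEquilibriumMeasure_iff (h : IsBandSystem α p x y) (hα : ∀ n, ‖α n‖ < 1) (hp : 0 < p)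
    (hpe : Even p) {κ : Measure ℂ} :
    IsEquilibriumMeasure (bandSet α p) κ ↔ κ = bandMeasure α p x y :=
  haveI := h.isProbabilityMeasure_bandMeasure hα hp
  isEquilibriumMeasure_iff_of_potential (fun _ hz => hz.1) (h.bandMeasure_compl_bandSet hα hp hpe)
    (h.bandMeasure_singleton hα hp hpe) fun _ hz => h.bandMeasure_potential hα hp hpe hz

/-! ### The distribution function of the equilibrium measure -/

theorem arcMass_eq_sum (h : IsBandSystem α p x y) (hα : ∀ n, ‖α n‖ < 1) (hp : 0 < p)
    {φ : ℝ} (hφ : φ ≤ x 1 + 2 * Real.pi) :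
    arcMass (bandMeasure α p x y) (x 1) φ =
      (p * Real.pi)⁻¹ * ∑ j ∈ Finset.Icc 1 p, bandParam α p (x j) (y j) φ := by
  have hpi := Real.pi_pos
  have hinj : Set.InjOn circlePt (Set.Ioo (x 1) φ) := fun s hs t ht hst =>
    eq_of_circlePt_eq hst (by rw [abs_lt]; constructor <;> linarith [hs.1, hs.2, ht.1, ht.2])
  have hmeas : MeasurableSet (circlePt '' Set.Ioo (x 1) φ) :=
    measurableSet_Ioo.image_of_continuousOn_injOn continuous_circlePt.continuousOn hinj
  rw [arcMass, measureReal_def, h.bandMeasure_apply hα hp hmeas, ENNReal.toReal_sum, Finset.mul_sum]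
  · refine Finset.sum_congr rfl fun j hj => ?_
    have hj' := Finset.mem_Icc.1 hj
    rw [ENNReal.toReal_mul, ENNReal.toReal_ofReal (by positivity), bandParam, measureReal_def]
    congr 3
    rw [Set.inter_comm]
    ext t
    refine and_congr_right fun ht => ?_
    have h1 := (h.band j hj').levelPt_mem_Ioo hα hp ht
    have h2 := h.x_one_le hj'
    have h3 := h.y_le hj'
    simp only [Set.mem_ofPred_eq]
    constructor
    · rintro ⟨ψ, hψ, he⟩
      have := eq_of_circlePt_eq he
        (by rw [abs_lt]; constructor <;> linarith [h1.1, h1.2, hψ.1, hψ.2])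
      rw [← this]
      exact hψ.2
    · intro hlt
      exact ⟨_, ⟨h2.trans_lt h1.1, hlt⟩, rfl⟩
  · intro j _
    refine ENNReal.mul_ne_top ENNReal.ofReal_ne_top ?_
    refine ((measure_mono Set.inter_subset_right).trans_lt ?_).ne
    rw [Real.volume_Ioo]
    exact ENNReal.ofReal_lt_top

theorem arcMass_of_mem_band (h : IsBandSystem α p x y) (hα : ∀ n, ‖α n‖ < 1) (hp : 0 < p)
    {k : ℕ} (hk : k ∈ Set.Icc 1 p) {φ : ℝ} (hφ : φ ∈ Set.Icc (x k) (y k)) :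
    arcMass (bandMeasure α p x y) (x 1) φ =
      ((k : ℝ) - 1) / p + bandParam α p (x k) (y k) φ / (p * Real.pi) := by
  have hpi := Real.pi_pos
  have hp' : (0 : ℝ) < p := by exact_mod_cast hp
  rw [h.arcMass_eq_sum hα hp (hφ.2.trans (h.y_le hk))]
  have hterm : ∀ j ∈ Finset.Icc 1 p, bandParam α p (x j) (y j) φ =
      (if j ∈ Finset.Ico 1 k then Real.pi else 0)
        + (if j = k then bandParam α p (x k) (y k) φ else 0) := by
    intro j hj
    have hj' := Finset.mem_Icc.1 hj
    have hiff : j ∈ Finset.Ico 1 k ↔ 1 ≤ j ∧ j < k := Finset.mem_Ico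
    rcases lt_trichotomy j k with hlt | rfl | hlt
    · rw [if_pos (hiff.2 ⟨hj'.1, hlt⟩), if_neg hlt.ne, add_zero]
      exact (h.band j hj').bandParam_eq_pi hα hp
        ((h.y_le_x hj'.1 hlt (by have := hk.2; omega)).trans hφ.1)
    · rw [if_neg (by rw [hiff]; omega), if_pos rfl, zero_add]
    · rw [if_neg (by rw [hiff]; omega), if_neg hlt.ne', add_zero]
      exact (h.band j hj').bandParam_eq_zero hα hp
        (hφ.2.trans (h.y_le_x hk.1 hlt (by omega)))
  have hsub : Finset.Icc 1 p ∩ Finset.Ico 1 k = Finset.Ico 1 k := by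
    rw [Finset.inter_eq_right]
    intro j hj
    have := Finset.mem_Ico.1 hj
    have := hk.2
    exact Finset.mem_Icc.2 ⟨by omega, by omega⟩
  rw [Finset.sum_congr rfl hterm, Finset.sum_add_distrib, Finset.sum_ite_mem, hsub,
    Finset.sum_ite_eq', if_pos (Finset.mem_Icc.2 hk), Finset.sum_const, Nat.card_Ico, nsmul_eq_mul,
    Nat.cast_sub hk.1, Nat.cast_one]
  field_simp

theorem arcMass_mono (h : IsBandSystem α p x y) (hα : ∀ n, ‖α n‖ < 1) (hp : 0 < p) :
    Monotone (arcMass (bandMeasure α p x y) (x 1)) := by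
  have := h.isProbabilityMeasure_bandMeasure hα hp
  exact fun s t hst => measureReal_mono (Set.image_mono (Set.Ioo_subset_Ioo_right hst))

/-- The distribution function takes the value `(k - 1) / p + q / (m p)` at one point only, which
lies inside the `k`-th band and satisfies `Δ = 2 cos (r π / m)` for some `0 < r < m`. -/
theorem exists_arcMass_eq_iff (h : IsBandSystem α p x y) (hα : ∀ n, ‖α n‖ < 1) (hp : 0 < p)
    {m k q : ℕ} (hk : k ∈ Set.Icc 1 p) (hq : q ∈ Set.Ico 1 m) :
    ∃ θ ∈ Set.Ioo (x k) (y k),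
      (∃ r ∈ Set.Ico 1 m, realDisc α p θ = 2 * Real.cos (r * Real.pi / m)) ∧
      ∀ φ, arcMass (bandMeasure α p x y) (x 1) φ = ((k : ℝ) - 1) / p + (q : ℝ) / (m * p) ↔
        φ = θ := by
  have hpi := Real.pi_pos
  have hp' : (0 : ℝ) < p := by exact_mod_cast hp
  have hq1 : (0 : ℝ) < q := by exact_mod_cast hq.1
  have hqm : (q : ℝ) < m := by exact_mod_cast hq.2
  have hm : (0 : ℝ) < m := hq1.trans hqm
  have hb := h.band k hk
  have hmem : ∀ r ∈ Set.Ico 1 m, (r * Real.pi / m : ℝ) ∈ Set.Ioo 0 Real.pi := by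
    intro r hr
    have h1 : (0 : ℝ) < r := by exact_mod_cast hr.1
    have h2 : (r : ℝ) < m := by exact_mod_cast hr.2
    refine ⟨by positivity, ?_⟩
    rw [div_lt_iff₀ hm]
    nlinarith
  obtain ⟨r, hr, hpar⟩ : ∃ r ∈ Set.Ico 1 m,
      bandParam α p (x k) (y k) (levelPt α p (x k) (y k) (r * Real.pi / m)) = q * Real.pi / m := by
    rcases hb.bandParam_levelPt hα hp with hV | hV
    · exact ⟨q, hq, hV _ (hmem q hq)⟩
    · have hr : m - q ∈ Set.Ico 1 m := ⟨by have := hq.2; omega, by have := hq.1; have := hq.2; omega⟩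
      refine ⟨m - q, hr, ?_⟩
      rw [hV _ (hmem _ hr), Nat.cast_sub hq.2.le]
      field_simp
      ring
  have hθ := hb.levelPt_mem_Ioo hα hp (hmem r hr)
  have hiff : ∀ φ ∈ Set.Icc (x k) (y k),
      (arcMass (bandMeasure α p x y) (x 1) φ = ((k : ℝ) - 1) / p + (q : ℝ) / (m * p) ↔
        bandParam α p (x k) (y k) φ = q * Real.pi / m) := by
    intro φ hφ
    rw [h.arcMass_of_mem_band hα hp hk hφ, add_right_inj]
    constructor
    · intro he
      field_simp at he ⊢
      linarith
    · intro he
      rw [he]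
      field_simp
  refine ⟨_, hθ, ⟨r, hr, (hb.levelPt_spec hα hp _).2⟩, fun φ => ⟨fun he => ?_, ?_⟩⟩
  · have hφ : φ ∈ Set.Ioo (x k) (y k) := by
      by_contra hcon
      rw [Set.mem_Ioo, not_and_or, not_lt, not_lt] at hcon
      rcases hcon with hcon | hcon
      · have h1 := h.arcMass_mono hα hp hcon
        rw [he, h.arcMass_of_mem_band hα hp hk ⟨le_rfl, hb.lt.le⟩, hb.bandParam_eq_zero hα hp le_rfl,
          zero_div] at h1
        have : 0 < (q : ℝ) / (m * p) := by positivity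
        linarith
      · have h1 := h.arcMass_mono hα hp hcon
        rw [he, h.arcMass_of_mem_band hα hp hk ⟨hb.lt.le, le_rfl⟩,
          hb.bandParam_eq_pi hα hp le_rfl, add_le_add_iff_left, div_le_div_iff₀ (by positivity)
          (by positivity)] at h1
        have : 0 < (m - q) * (Real.pi * p) := mul_pos (by linarith) (by positivity)
        nlinarith
    rw [hiff φ (Set.Ioo_subset_Icc_self hφ), ← hpar] at he
    obtain ⟨s, hs, rfl⟩ := hb.exists_levelPt_eq hα hp hφ
    rcases hb.bandParam_levelPt hα hp with hV | hV
    · rw [hV s hs, hV _ (hmem r hr)] at he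
      rw [he]
    · rw [hV s hs, hV _ (hmem r hr), sub_right_inj] at he
      rw [he]
  · rintro rfl
    exact (hiff _ (Set.Ioo_subset_Icc_self hθ)).2 hpar

end IsBandSystem

/-! ### The zeros of the paraorthogonal polynomials -/

namespace IsBandSystem

variable {α : ℕ → ℂ} {p : ℕ} {x y : ℕ → ℝ}

/-- A Dirichlet point in each gap and `m - 1` points with `Δ = 2 cos (r π / m)` in each band account
for all the zeros of `Φ_{mp} - Φ_{mp}^*`, since their number is the degree. Here
`d j` is the chosen Dirichlet angle in the `j`-th gap, `e j q` the `q`-th angle in the `j`-th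
band, and `q = 0` stands for the Dirichlet angle in the index set. -/
theorem roots_phi_sub_phiStar (h : IsBandSystem α p x y) (hα : ∀ n, ‖α n‖ < 1) (hp : 0 < p)
    (hper : ∀ n, α (n + p) = α n) {m : ℕ} (hm : 1 ≤ m) {d : ℕ → ℝ} {e : ℕ → ℕ → ℝ}
    (hd : ∀ j ∈ Set.Icc 1 p, d j ∈ Set.Icc (y j) (x (j + 1)))
    (hd0 : ∀ j ∈ Set.Icc 1 p, dirichletFun α p (d j) = 0)
    (he : ∀ j ∈ Set.Icc 1 p, ∀ q ∈ Set.Ico 1 m, e j q ∈ Set.Ioo (x j) (y j))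
    (he0 : ∀ j ∈ Set.Icc 1 p, ∀ q ∈ Set.Ico 1 m,
      ∃ r ∈ Set.Ico 1 m, realDisc α p (e j q) = 2 * Real.cos (r * Real.pi / m))
    (heinj : ∀ j ∈ Set.Icc 1 p, Set.InjOn (e j) (Set.Ico 1 m)) :
    (Phi α (m * p) - PhiStar α (m * p)).roots.Nodup ∧
      (Phi α (m * p) - PhiStar α (m * p)).roots.card = m * p ∧
      ∀ z, (Phi α (m * p) - PhiStar α (m * p)).eval z = 0 ↔
        (∃ j ∈ Set.Icc 1 p, z = circlePt (d j)) ∨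
          ∃ j ∈ Set.Icc 1 p, ∃ q ∈ Set.Ico 1 m, z = circlePt (e j q) := by
  have hpi := Real.pi_pos
  set ψ : Finset.Icc 1 p × Fin m → ℝ := fun i =>
    if (i.2 : ℕ) = 0 then d i.1 else e i.1 i.2 with hψ
  have hmem : ∀ j : Finset.Icc 1 p, (j : ℕ) ∈ Set.Icc 1 p := fun j => Finset.mem_Icc.1 j.2
  have hq : ∀ q : Fin m, (q : ℕ) ≠ 0 → (q : ℕ) ∈ Set.Ico 1 m := fun q h0 =>
    ⟨Nat.one_le_iff_ne_zero.2 h0, q.2⟩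
  have hrange : ∀ i, ψ i ∈ Set.Ioc (x i.1) (x (i.1 + 1)) := by
    intro i
    have hb := (h.band _ (hmem i.1)).lt
    by_cases h0 : (i.2 : ℕ) = 0
    · simp only [hψ, h0, if_true]
      have := hd _ (hmem i.1)
      exact ⟨hb.trans_le this.1, this.2⟩
    · simp only [hψ, h0, if_false]
      have := he _ (hmem i.1) _ (hq _ h0)
      exact ⟨this.1, this.2.le.trans (h.gap_le _ (hmem i.1))⟩
  have hlt : ∀ i i', (i.1 : ℕ) < i'.1 → ψ i < ψ i' := fun i i' hii =>
    ((hrange i).2.trans (h.x_le_x (by omega) hii (by have := (hmem i'.1).2; omega))).trans_lt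
      (hrange i').1
  have hψinj : Function.Injective ψ := by
    rintro ⟨j, q⟩ ⟨j', q'⟩ hjq
    rcases lt_trichotomy (j : ℕ) j' with hl | hjj | hl
    · exact absurd hjq (hlt (j, q) (j', q') hl).ne
    · have hjj' : j = j' := Subtype.ext hjj
      subst hjj'
      have hdj := hd _ (hmem j)
      have hqq : q = q' := by
        by_cases h0 : (q : ℕ) = 0 <;> by_cases h0' : (q' : ℕ) = 0
        · exact Fin.ext (h0.trans h0'.symm)
        · simp only [hψ, h0, h0', if_true, if_false] at hjq
          have := he _ (hmem j) _ (hq _ h0')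
          linarith [this.2, hdj.1]
        · simp only [hψ, h0, h0', if_true, if_false] at hjq
          have := he _ (hmem j) _ (hq _ h0)
          linarith [this.2, hdj.1]
        · simp only [hψ, h0, h0', if_false] at hjq
          exact Fin.ext (heinj _ (hmem j) (hq _ h0) (hq _ h0') hjq)
      rw [hqq]
    · exact absurd hjq (hlt (j', q') (j, q) hl).ne'
  have hinj : Function.Injective fun i => circlePt (ψ i) := by
    intro i i' hii
    refine hψinj (eq_of_circlePt_eq hii ?_)
    have h1 : ∀ i, ψ i ∈ Set.Ioc (x 1) (x 1 + 2 * Real.pi) := fun i =>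
      ⟨(h.x_one_le (hmem i.1)).trans_lt (hrange i).1, (hrange i).2.trans
        ((h.x_le_x (by omega) (by have := (hmem i.1).2; omega) le_rfl).trans_eq h.wrap)⟩
    rw [abs_lt]
    constructor <;> linarith [(h1 i).1, (h1 i).2, (h1 i').1, (h1 i').2]
  have hm0 : (0 : ℝ) < m := by exact_mod_cast hm
  have hzero : ∀ i, (Phi α (m * p) - PhiStar α (m * p)).eval (circlePt (ψ i)) = 0 := by
    intro i
    by_cases h0 : (i.2 : ℕ) = 0
    · simp only [hψ, h0, if_true]
      exact phi_sub_phiStar_eval_of_isDirichletPoint hα hper m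
        ((isDirichletPoint_circlePt_iff α p _).2 (hd0 _ (hmem i.1)))
    · simp only [hψ, h0, if_false]
      obtain ⟨r, hr, hD⟩ := he0 _ (hmem i.1) _ (hq _ h0)
      have hr1 : (0 : ℝ) < r := by exact_mod_cast hr.1
      have hr2 : (r : ℝ) < m := by exact_mod_cast hr.2
      refine phi_sub_phiStar_eval_of_realDisc hα hper m hD ?_ ?_
      · refine (Real.sin_pos_of_pos_of_lt_pi (by positivity) ?_).ne'
        rw [div_lt_iff₀ hm0]
        nlinarith
      · rw [mul_div_cancel₀ _ hm0.ne', Real.sin_nat_mul_pi]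
  have hne := phi_sub_phiStar_ne_zero hα (Nat.mul_pos hm hp)
  have hcard : Fintype.card (Finset.Icc 1 p × Fin m) = m * p := by
    simp [mul_comm]
  have hroots := roots_eq_map_of_injective hne
    ((phi_sub_phiStar_natDegree_le α (m * p)).trans_eq hcard.symm) hinj hzero
  refine ⟨?_, ?_, fun z => ?_⟩
  · rw [hroots]
    exact Multiset.Nodup.map hinj Finset.univ.nodup
  · rw [hroots, Multiset.card_map]
    exact hcard
  · rw [← IsRoot, ← mem_roots hne, hroots, Multiset.mem_map]
    constructor
    · rintro ⟨i, -, rfl⟩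
      by_cases h0 : (i.2 : ℕ) = 0
      · exact Or.inl ⟨i.1, hmem i.1, by simp only [hψ, h0, if_true]⟩
      · exact Or.inr ⟨i.1, hmem i.1, i.2, hq _ h0, by simp only [hψ, h0, if_false]⟩
    · rintro (⟨j, hj, rfl⟩ | ⟨j, hj, q, hqm, rfl⟩)
      · exact ⟨(⟨j, Finset.mem_Icc.2 hj⟩, ⟨0, hm⟩), Finset.mem_univ _, by simp [hψ]⟩
      · have : q ≠ 0 := by
          have := hqm.1
          omega
        exact ⟨(⟨j, Finset.mem_Icc.2 hj⟩, ⟨q, hqm.2⟩), Finset.mem_univ _, by simp [hψ, this]⟩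

end IsBandSystem

end Potential

end PeriodicOPUC

open PeriodicOPUC in
theorem theorem3p1 (α : ℕ → ℂ) (hα : ∀ n, ‖α n‖ < 1) (p : ℕ) (hp : 0 < p) (hp_even : Even p)
    (hper : ∀ n, α (n + p) = α n) :
    -- the band edges and the equilibrium measure of the bands exist
    (∃ x y : ℕ → ℝ, IsBandEdges α p x y) ∧
    (∃! κ : MeasureTheory.Measure ℂ, IsEquilibriumMeasure (bandSet α p) κ) ∧
    ∀ (x y : ℕ → ℝ), IsBandEdges α p x y →
    ∀ κ : MeasureTheory.Measure ℂ, IsEquilibriumMeasure (bandSet α p) κ →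
      -- the Dirichlet data points: exactly one in each (closure of a) gap, and no others
      (∀ j ∈ Set.Icc 1 p, ∃! θ : ℝ, θ ∈ Set.Icc (y j) (x (j + 1)) ∧
        IsDirichletPoint α p (circlePt θ)) ∧
      (∀ z : ℂ, IsDirichletPoint α p z →
        ∃ j ∈ Set.Icc 1 p, ∃ θ ∈ Set.Icc (y j) (x (j + 1)), z = circlePt θ) ∧
      ∀ m : ℕ, 1 ≤ m →
        -- exactly one point for each pair `(k, q)`, in the interior of the `k`-th band
        (∀ k ∈ Set.Icc 1 p, ∀ q ∈ Set.Ico 1 m,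
          ∃ θ ∈ Set.Ioo (x k) (y k), ∀ φ ∈ Set.Ico (x 1) (x 1 + 2 * Real.pi),
            arcMass κ (x 1) φ = ((k : ℝ) - 1) / p + (q : ℝ) / (m * p) ↔ φ = θ) ∧
        -- the zeros are exactly these points
        (∀ z : ℂ, (Phi α (m * p) - PhiStar α (m * p)).eval z = 0 ↔
          IsDirichletPoint α p z ∨
          ∃ k ∈ Set.Icc 1 p, ∃ q ∈ Set.Ico 1 m, ∃ θ ∈ Set.Ico (x 1) (x 1 + 2 * Real.pi),
            z = circlePt θ ∧
            arcMass κ (x 1) θ = ((k : ℝ) - 1) / p + (q : ℝ) / (m * p)) ∧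
        -- there are `p + (m - 1) p = m p` of them, all simple
        (Phi α (m * p) - PhiStar α (m * p)).roots.Nodup ∧
        (Phi α (m * p) - PhiStar α (m * p)).roots.card = m * p := by
  obtain ⟨x₀, y₀, hx₀, hsys₀⟩ := exists_isBandSystem hα hp hp_even
  refine ⟨⟨x₀, y₀, hsys₀.isBandEdges hα hp hp_even hx₀⟩,
    ⟨bandMeasure α p x₀ y₀, (hsys₀.isEquilibriumMeasure_iff hα hp hp_even).2 rfl,
      fun κ hκ => (hsys₀.isEquilibriumMeasure_iff hα hp hp_even).1 hκ⟩, ?_⟩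
  intro x y hxy κ hκ
  have h := hxy.isBandSystem hp_even
  obtain rfl := (h.isEquilibriumMeasure_iff hα hp hp_even).1 hκ
  have hpi := Real.pi_pos
  choose! d hd hd0 using fun j (hj : j ∈ Set.Icc 1 p) =>
    h.exists_dirichletFun_eq_zero hα hp hp_even hj
  -- The polynomial `Φ_p - Φ_p^*` shows that there are no further Dirichlet points.
  have hdir : ∀ z : ℂ, IsDirichletPoint α p z → ∃ j ∈ Set.Icc 1 p, z = circlePt (d j) := by
    intro z hz
    obtain ⟨-, -, hroot⟩ := h.roots_phi_sub_phiStar hα hp hper (le_refl 1) (e := fun _ _ => 0) hd hd0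
      (fun j _ q hq => absurd hq.1 hq.2.not_ge) (fun j _ q hq => absurd hq.1 hq.2.not_ge)
      fun j _ q hq => absurd hq.1 hq.2.not_ge
    rcases (hroot z).1 (phi_sub_phiStar_eval_of_isDirichletPoint hα hper 1 hz) with
      hj | ⟨j, -, q, hq, -⟩
    · exact hj
    · exact absurd hq.1 hq.2.not_ge
  have hdir' : ∀ j ∈ Set.Icc 1 p, IsDirichletPoint α p (circlePt (d j)) := fun j hj =>
    (isDirichletPoint_circlePt_iff α p _).2 (hd0 j hj)
  have hrange : ∀ j ∈ Set.Icc 1 p, ∀ θ ∈ Set.Icc (y j) (x (j + 1)),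
      θ ∈ Set.Ioc (x 1) (x 1 + 2 * Real.pi) := fun j hj θ hθ =>
    ⟨(h.x_one_le hj).trans_lt ((h.band j hj).lt.trans_le hθ.1), hθ.2.trans
      ((h.x_le_x (by omega) (by have := hj.2; omega) le_rfl).trans_eq h.wrap)⟩
  refine ⟨fun j hj => ⟨d j, ⟨hd j hj, hdir' j hj⟩, ?_⟩, fun z hz => ?_, fun m hm => ?_⟩
  · rintro θ ⟨hθ, hθz⟩
    obtain ⟨k, hk, he⟩ := hdir _ hθz
    have h1 := hrange j hj θ hθ
    have h2 := hrange k hk _ (hd k hk)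
    have h3 := eq_of_circlePt_eq he
      (by rw [abs_lt]; constructor <;> linarith [h1.1, h1.2, h2.1, h2.2])
    have hdk := hd k hk
    rw [← h3] at hdk
    rcases lt_trichotomy j k with hl | rfl | hl
    · have h4 := h.x_le_x (j := j + 1) (by omega) hl (by have := hk.2; omega)
      linarith [hθ.2, hdk.1, (h.band k hk).lt]
    · exact h3
    · have h4 := h.x_le_x (j := k + 1) (by omega) hl (by have := hj.2; omega)
      linarith [hθ.1, hdk.2, (h.band j hj).lt]
  · obtain ⟨j, hj, he⟩ := hdir z hz
    exact ⟨j, hj, d j, hd j hj, he⟩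
  · have hm0 : (0 : ℝ) < m := by exact_mod_cast hm
    have hp0 : (0 : ℝ) < p := by exact_mod_cast hp
    choose! e he he0 heiff using fun j (hj : j ∈ Set.Icc 1 p) q (hq : q ∈ Set.Ico 1 m) =>
      h.exists_arcMass_eq_iff hα hp hj hq
    have heinj : ∀ j ∈ Set.Icc 1 p, Set.InjOn (e j) (Set.Ico 1 m) := by
      intro j hj q hq q' hq' hqq
      have h1 := (heiff j hj q hq (e j q)).2 rfl
      rw [(heiff j hj q' hq' (e j q)).2 hqq, add_right_inj,
        div_left_inj' (by positivity)] at h1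
      exact_mod_cast h1.symm
    have heIco : ∀ j ∈ Set.Icc 1 p, ∀ q ∈ Set.Ico 1 m,
        e j q ∈ Set.Ico (x 1) (x 1 + 2 * Real.pi) := fun j hj q hq =>
      ⟨(h.x_one_le hj).trans (he j hj q hq).1.le, (he j hj q hq).2.trans_le (h.y_le hj)⟩
    obtain ⟨hnodup, hcard, hroot⟩ := h.roots_phi_sub_phiStar hα hp hper hm hd hd0 he he0 heinj
    refine ⟨fun k hk q hq => ⟨e k q, he k hk q hq, fun φ _ => heiff k hk q hq φ⟩, fun z => ?_,
      hnodup, hcard⟩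
    rw [hroot z]
    refine or_congr ⟨?_, hdir z⟩ ⟨?_, ?_⟩
    · rintro ⟨j, hj, rfl⟩
      exact hdir' j hj
    · rintro ⟨k, hk, q, hq, rfl⟩
      exact ⟨k, hk, q, hq, e k q, heIco k hk q hq, rfl, (heiff k hk q hq _).2 rfl⟩
    · rintro ⟨k, hk, q, hq, θ, -, rfl, hθ⟩
      exact ⟨k, hk, q, hq, by rw [(heiff k hk q hq θ).1 hθ]⟩
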